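/- **Setting.** A *process template* $P$ consists of a finite state set $Q$ partitioned into non-empty sets $T$ (states that have the token) and $N$, a finite non-empty set $\Sigma_{\mathrm{int}}$ of internal labels, two initial states $\iota_t\in T$ and $\iota_n\in N$, a labeling of each state by a finite set of atoms from a fixed countably infinite set $\mathrm{AP}$, and a transition relation $\delta\subseteq Q\times(\Sigma_{\mathrm{int}}\cup\{\mathsf{snd},\mathsf{rcv}\})\times Q$ such that: $\mathsf{snd}$-transitions lead from $T$ to $N$; $\mathsf{rcv}$-transitions lead from $N$ to $T$; internal transitions stay in $T$ or stay in $N$; every state has an outgoing transition; and the label sequence of every infinite path of $P$ lies in $(\Sigma_{\mathrm{int}}^*\,\mathsf{snd}\,\Sigma_{\mathrm{int}}^*\,\mathsf{rcv})^\omega\cup(\Sigma_{\mathrm{int}}^*\,\mathsf{rcv}\,\Sigma_{\mathrm{int}}^*\,\mathsf{snd})^\omega$. A *topology* $G=(V,E,x)$ is a finite directed graph without self-loops, with $V=\{1,\dots,n\}$, $n\ge 1$, and an initial vertex $x\in V$. The (direction-unaware) *token-passing system* $P^G$ has state set $Q^V$; in its unique initial state the process at $x$ is in $\iota_t$ and all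 other processes are in $\iota_n$. In a step, either one process makes an internal transition, or, for some $(v,w)\in E$, the process at $v$ makes a $\mathsf{snd}$-transition and simultaneously the process at $w$ makes an $\mathsf{rcv}$-transition; all other processes stay put. The atom $p_v$ holds in a global state if $p$ labels the local state of the process at $v$. For $k\ge 0$, a *$k$-indexed universal* $\mathrm{CTL}^*\backslash\mathrm{X}$ formula has the form $\forall x_1\dots\forall x_k.\ \varphi$, where the variables range over $V$, each quantifier may also be guarded ($\forall x_i\in Y$ with $Y$ a finite set of earlier variables, or $\forall x_i\in E(x_j)$ with $j<i$), and $\varphi$ is a $\mathrm{CTL}^*$ state formula without the next operator over the atoms $p_{x_i}$. Path quantifiers range over those infinite runs of $P^G$ in which the token visits every process infinitely often; all other runs are ignored. $P^G\models\Phi$ means that $\Phi$ holds at the initial state of $P^G$. Let $\mathbf G$ be a set of topologies. The *parameterized model checking problem* for $\mathbf G$ is: given $P$ and $\Phi$, does $P^G\models\Phi$ hold for all $G\in\mathbf G$? A number $c$ is a *cutoff* for $\mathbf G$ and $k$-indexed universal formulas if for every process template $P$ and every such formula $\Phi$: $P^G\models\Phi$ for all $G\in\mathbf G$ with $|V_G|\le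 c$ if and only if $P^G\models\Phi$ for all $G\in\mathbf G$. **Theorem.** Consider the following families, in each of which every vertex is allowed as the initial vertex. * Uni-directional rings: $V=\{1,\dots,n\}$ with the edges $(i,i+1)$ modulo $n$, where $n\ge 2$. * Bi-directional rings: $V=\{1,\dots,n\}$ with the edges $(i,i+1)$ and $(i+1,i)$ modulo $n$, where $n\ge 2$. * Cliques: all edges between distinct vertices. * Stars: edges in both directions between one center and every other vertex, and no other edges. Then for every $k\ge 1$ and $k$-indexed universal $\mathrm{CTL}^*\backslash\mathrm{X}$ formulas: 1. $2k$ is a cutoff for the uni-directional rings; 2. $2k$ is a cutoff for the bi-directional rings; 3. $k+1$ is a cutoff for the cliques; 4. $k+1$ is a cutoff for the stars. Moreover, for each of these families the parameterized model checking problem for universal prenex indexed $\mathrm{CTL}^*\backslash\mathrm{X}$ formulas (with any number of index quantifiers) is decidable: a single algorithm, given (finite descriptions of) $P$ and $\Phi$, answers it. For cliques and for stars, all of this holds both when the one-vertex graph is counted as a member of the family and when it is not. -/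

import Mathlib

universe u v w

namespace TokenPassing

/-! ## Labeled transition systems -/

/-- A labeled transition system over atomic propositions `AP`, with state set `S` and set of
transition labels `A`. -/
structure LTS (AP : Type u) (S : Type v) (A : Type w) where
  init : Set S
  trans : S → A → S → Prop
  label : S → Set AP
  label_finite : ∀ s, (label s).Finite

/-- `π` is an infinite path of `M` (the projection to states of an infinite state-action path). -/
def LTS.IsPath {AP : Type u} {S : Type v} {A : Type w} (M : LTS AP S A) (π : ℕ → S) : Prop :=
  ∀ i, ∃ a, M.trans (π i) a (π (i + 1))

/-! ## The temporal logic CTL* without the next operator -/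

mutual
/-- State formulas over `AP`. -/
inductive StateFormula (AP : Type u) : Type u
  | tt : StateFormula AP
  | atom : AP → StateFormula AP
  | neg : StateFormula AP → StateFormula AP
  | and : StateFormula AP → StateFormula AP → StateFormula AP
  | ex : PathFormula AP → StateFormula AP
/-- Path formulas over `AP`. -/
inductive PathFormula (AP : Type u) : Type u
  | state : StateFormula AP → PathFormula AP
  | neg : PathFormula AP → PathFormula AP
  | and : PathFormula AP → PathFormula AP → PathFormula AP
  | untl : PathFormula AP → PathFormula AP → PathFormula AP
end

mutual
/-- Replace every atom `p` of a state formula by `f p`. -/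
def StateFormula.map {AP : Type u} {AP' : Type v} (f : AP → AP') :
    StateFormula AP → StateFormula AP'
  | .tt => .tt
  | .atom p => .atom (f p)
  | .neg φ => .neg (φ.map f)
  | .and φ χ => .and (φ.map f) (χ.map f)
  | .ex ψ => .ex (ψ.map f)
/-- Replace every atom `p` of a path formula by `f p`. -/
def PathFormula.map {AP : Type u} {AP' : Type v} (f : AP → AP') :
    PathFormula AP → PathFormula AP'
  | .state φ => .state (φ.map f)
  | .neg ψ => .neg (ψ.map f)
  | .and ψ χ => .and (ψ.map f) (χ.map f)
  | .untl ψ χ => .untl (ψ.map f) (χ.map f)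
end

mutual
/-- Satisfaction of a state formula at a state, where path quantifiers range over the infinite
paths that belong to the set `F` of fair ones. -/
def LTS.SatState {AP : Type u} {S : Type v} {A : Type w} (M : LTS AP S A) (F : Set (ℕ → S)) :
    StateFormula AP → S → Prop
  | .tt, _ => True
  | .atom p, s => p ∈ M.label s
  | .neg φ, s => ¬ M.SatState F φ s
  | .and φ χ, s => M.SatState F φ s ∧ M.SatState F χ s
  | .ex ψ, s => ∃ π : ℕ → S, M.IsPath π ∧ π ∈ F ∧ π 0 = s ∧ M.SatPath F ψ π
/-- Satisfaction of a path formula along a path. -/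
def LTS.SatPath {AP : Type u} {S : Type v} {A : Type w} (M : LTS AP S A) (F : Set (ℕ → S)) :
    PathFormula AP → (ℕ → S) → Prop
  | .state φ, π => M.SatState F φ (π 0)
  | .neg ψ, π => ¬ M.SatPath F ψ π
  | .and ψ χ, π => M.SatPath F ψ π ∧ M.SatPath F χ π
  | .untl ψ χ, π => ∃ j, M.SatPath F χ (fun n => π (j + n)) ∧
      ∀ i < j, M.SatPath F ψ (fun n => π (i + n))
end

/-- `M ⊨ φ`: every initial state satisfies `φ`. -/
def LTS.Models {AP : Type u} {S : Type v} {A : Type w} (M : LTS AP S A) (F : Set (ℕ → S))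
    (φ : StateFormula AP) : Prop :=
  ∀ s ∈ M.init, M.SatState F φ s

/-! ## Process templates, topologies and token-passing systems -/

/-- Transition labels of a process template with internal labels `A`. -/
inductive ProcAction (A : Type u) : Type u
  | int : A → ProcAction A
  | snd : ProcAction A
  | rcv : ProcAction A

/-- `α` lies in `(int* snd int* rcv)^ω ∪ (int* rcv int* snd)^ω`; here `f` enumerates the positions
of the letters that are not internal. -/
def Alternates {A : Type u} (α : ℕ → ProcAction A) : Prop :=
  ∃ f : ℕ → ℕ, StrictMono f ∧ (∀ i, i ∉ Set.range f ↔ ∃ a, α i = .int a) ∧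
    ((∀ m, α (f (2 * m)) = .snd ∧ α (f (2 * m + 1)) = .rcv) ∨
     (∀ m, α (f (2 * m)) = .rcv ∧ α (f (2 * m + 1)) = .snd))

/-- Direction-unaware process templates with state set `Q` and internal transition labels `A`,
over the countably infinite set `ℕ` of local atomic propositions. The states in `token` have the
token, the others do not. -/
structure ProcessTemplate (Q : Type u) (A : Type v) extends LTS ℕ Q (ProcAction A) where
  finite_states : Finite Q
  finite_int : Finite A
  nonempty_int : Nonempty A
  token : Set Q
  initTok : Q
  initNon : Q
  initTok_mem : initTok ∈ token
  initNon_notMem : initNon ∉ token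
  init_eq : init = {initTok, initNon}
  trans_snd : ∀ q q', trans q .snd q' → q ∈ token ∧ q' ∉ token
  trans_rcv : ∀ q q', trans q .rcv q' → q ∉ token ∧ q' ∈ token
  trans_int : ∀ q a q', trans q (.int a) q' → (q ∈ token ↔ q' ∈ token)
  total : ∀ q, ∃ σ q', trans q σ q'
  alternates : ∀ (π : ℕ → Q) (α : ℕ → ProcAction A),
    (∀ i, trans (π i) (α i) (π (i + 1))) → Alternates α

/-- A topology: a finite directed graph without self-loops, with an initial vertex. -/
structure Topology where
  size : ℕ
  edge : Fin size → Fin size → Prop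
  init : Fin size
  irrefl : ∀ i, ¬ edge i i

/-- Transition labels of a token-passing system. -/
inductive SysAction (A : Type u) : Type u
  | int : A → SysAction A
  | tok : SysAction A

/-- The token-passing system `P^G`. Its atom `(p, i)` says that `p` holds of the process at
vertex `i`. -/
def system {Q : Type u} {A : Type v} (P : ProcessTemplate Q A) (G : Topology) :
    LTS (ℕ × Fin G.size) (Fin G.size → Q) (SysAction A) where
  init := {s | ∀ i, s i ∈ P.init ∧ (s i ∈ P.token ↔ i = G.init)}
  trans s σ s' :=
    match σ with
    | .int a => ∃ i, P.trans (s i) (.int a) (s' i) ∧ ∀ j, j ≠ i → s j = s' j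
    | .tok => ∃ i j, G.edge i j ∧ P.trans (s i) .snd (s' i) ∧ P.trans (s j) .rcv (s' j) ∧
        ∀ l, l ≠ i → l ≠ j → s' l = s l
  label s := {x | x.1 ∈ P.label (s x.2)}
  label_finite s := by
    refine (Set.finite_iUnion fun i => (P.label_finite (s i)).image fun p => (p, i)).subset ?_
    rintro ⟨p, i⟩ h
    exact Set.mem_iUnion.2 ⟨i, p, h, rfl⟩

/-- The runs of `P^G` in which the token visits every process infinitely often. -/
def fairRuns {Q : Type u} {A : Type v} (P : ProcessTemplate Q A) (G : Topology) :
    Set (ℕ → Fin G.size → Q) :=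
  {π | ∀ i, ∃ᶠ t in Filter.atTop, π t i ∈ P.token}

/-! ## Universal prenex indexed CTL* without next -/

/-- The guard of an index quantifier that is in the scope of `j` index variables: `∀ x`,
`∀ x ∈ Y` for a finite set `Y` of these variables, or `∀ x ∈ E(y)` for one of them. -/
inductive Guard (j : ℕ) : Type
  | none : Guard j
  | mem : List (Fin j) → Guard j
  | edge : Fin j → Guard j

/-- The vertex `x` satisfies the guard, when `g` gives the values of the variables in scope. -/
def Guard.Holds {j : ℕ} (G : Topology) (g : Fin j → Fin G.size) (x : Fin G.size) :
    Guard j → Prop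
  | .none => True
  | .mem Y => ∃ y ∈ Y, x = g y
  | .edge y => G.edge (g y) x

/-- The `k`-indexed universal sentence `∀ x₀ … ∀ xₖ₋₁. φ`, where each quantifier may be guarded by
earlier variables and `φ` is a state formula over the atoms `(p, xᵢ)`. -/
structure UnivFormula (k : ℕ) where
  guard : (i : Fin k) → Guard i
  matrix : StateFormula (ℕ × Fin k)

/-- `P^G ⊨ Φ`, with path quantifiers ignoring the runs in which the token does not visit every
process infinitely often. -/
def Sat {Q : Type u} {A : Type v} (P : ProcessTemplate Q A) (G : Topology) {k : ℕ}
    (Φ : UnivFormula k) : Prop :=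
  ∀ g : Fin k → Fin G.size,
    (∀ i : Fin k, (Φ.guard i).Holds G (fun j => g (Fin.castLE i.isLt.le j)) (g i)) →
    (system P G).Models (fairRuns P G) (Φ.matrix.map fun x => (x.1, g x.2))

/-! ## Cutoffs and decidability -/

/-- `c` is a cutoff for the parameterized model checking problem of the family `𝒢`,
direction-unaware process templates and `k`-indexed universal formulas. -/
def IsCutoff (𝒢 : Set Topology) (k c : ℕ) : Prop :=
  ∀ (Q : Type u) (A : Type v) (P : ProcessTemplate Q A) (Φ : UnivFormula k),
    (∀ G ∈ 𝒢, G.size ≤ c → Sat P G Φ) ↔ ∀ G ∈ 𝒢, Sat P G Φ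

mutual
/-- The Gödel number of a state formula. -/
def StateFormula.code {k : ℕ} : StateFormula (ℕ × Fin k) → ℕ
  | .tt => Nat.pair 0 0
  | .atom x => Nat.pair 1 (Nat.pair x.1 x.2)
  | .neg φ => Nat.pair 2 φ.code
  | .and φ χ => Nat.pair 3 (Nat.pair φ.code χ.code)
  | .ex ψ => Nat.pair 4 ψ.code
/-- The Gödel number of a path formula. -/
def PathFormula.code {k : ℕ} : PathFormula (ℕ × Fin k) → ℕ
  | .state φ => Nat.pair 5 φ.code
  | .neg ψ => Nat.pair 6 ψ.code
  | .and ψ χ => Nat.pair 7 (Nat.pair ψ.code χ.code)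
  | .untl ψ χ => Nat.pair 8 (Nat.pair ψ.code χ.code)
end

/-- The code of a guard. -/
def Guard.code {j : ℕ} : Guard j → ℕ × List ℕ
  | .none => (0, [])
  | .mem Y => (1, Y.map fun y => (y : ℕ))
  | .edge y => (2, [(y : ℕ)])

/-- Codes of universal formulas: number of quantifiers, guards, matrix. -/
abbrev FormulaCode : Type := ℕ × List (ℕ × List ℕ) × ℕ

/-- The code of a universal formula. -/
def UnivFormula.code {k : ℕ} (Φ : UnivFormula k) : FormulaCode :=
  (k, List.ofFn fun i => (Φ.guard i).code, Φ.matrix.code)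

/-- The code of a transition label. -/
def ProcAction.code {a : ℕ} : ProcAction (Fin a) → ℕ
  | .snd => 0
  | .rcv => 1
  | .int x => x + 2

/-- Finite descriptions of process templates: number of states, number of internal labels, list of
the states that have the token, the initial state with the token, the initial state without it,
list of the transitions, list of the pairs of a state and an atom that holds in it. -/
abbrev TemplateCode : Type :=
  ℕ × ℕ × List ℕ × ℕ × ℕ × List (ℕ × ℕ × ℕ) × List (ℕ × ℕ)

/-- The finite description on the left describes `P`. -/
def Describes {q a : ℕ} : TemplateCode → ProcessTemplate (Fin q) (Fin a) → Prop
  | (nq, na, tok, ιt, ιn, δ, lab), P =>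
    nq = q ∧ na = a ∧ (∀ s : Fin q, (s : ℕ) ∈ tok ↔ s ∈ P.token) ∧
    ιt = P.initTok ∧ ιn = P.initNon ∧
    (∀ (s : Fin q) (σ : ProcAction (Fin a)) (s' : Fin q),
      ((s : ℕ), σ.code, (s' : ℕ)) ∈ δ ↔ P.trans s σ s') ∧
    (∀ (s : Fin q) (p : ℕ), ((s : ℕ), p) ∈ lab ↔ p ∈ P.label s)

/-- The parameterized model checking problem of the family `𝒢`, direction-unaware process
templates and universal prenex indexed formulas is decidable: one algorithm answers it for every
formula, with any number of index quantifiers, and every process template. -/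
def PMCPDecidable (𝒢 : Set Topology) : Prop :=
  ∃ f : FormulaCode × TemplateCode → Bool, Computable f ∧
    ∀ (k : ℕ) (Φ : UnivFormula k) (q a : ℕ) (P : ProcessTemplate (Fin q) (Fin a))
      (c : TemplateCode), Describes c P →
      (f (Φ.code, c) = true ↔ ∀ G ∈ 𝒢, Sat P G Φ)

/-! ## The topology families -/

/-- Uni-directional rings, with every choice of the initial vertex. As a topology has no
self-loops, they have at least two vertices. -/
def uniRings : Set Topology :=
  {G | ∀ i j, G.edge i j ↔ (j : ℕ) = (i + 1) % G.size}

/-- Bi-directional rings, with every choice of the initial vertex. As a topology has no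
self-loops, they have at least two vertices. -/
def biRings : Set Topology :=
  {G | ∀ i j, G.edge i j ↔ ((j : ℕ) = (i + 1) % G.size ∨ (i : ℕ) = (j + 1) % G.size)}

/-- Cliques with at least `m` vertices, with every choice of the initial vertex. -/
def cliques (m : ℕ) : Set Topology :=
  {G | m ≤ G.size ∧ ∀ i j, G.edge i j ↔ i ≠ j}

/-- Stars with at least `m` vertices, with every choice of the initial vertex: there are edges in
both directions between the center and every other vertex, and no further edges. -/
def stars (m : ℕ) : Set Topology :=
  {G | m ≤ G.size ∧ ∃ h, ∀ i j, G.edge i j ↔ (i ≠ j ∧ (i = h ∨ j = h))}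

end TokenPassing

namespace TokenPassing

/-! ## Infinite concatenation of finite paths -/

-- The cutoffs come from contracting a topology by one vertex while keeping the selected vertices
-- (the values of the index variables) apart. Let `c` map `G` onto `H` so that every selected vertex
-- is alone in its fiber, edges between different fibers project to edges of `H`, and every edge of
-- `H` can be followed in `G` between any prescribed representatives of the two fibers, using moves
-- inside these fibers (`Contraction`). Relate a global state of `P^G` to one of `P^H` if selected
-- processes have equal local states and the tokens lie over the same vertex of `H` (`SimRel`). This
-- is a fair stuttering bisimulation, and such bisimulations preserve formulas without the next
-- operator (`satState_congr`).
--
-- The relation can be maintained because processes are never stuck with respect to the token: by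
-- totality and the alternation of sends and receives, a process that has the token can send after
-- finitely many internal steps, and a process without it can receive after finitely many internal
-- steps. Fibers with several vertices contain only unselected vertices, so this preparation and all
-- moves inside fibers are invisible. Fairness takes more care. The simulating system may choose
-- which vertex of a fiber holds the token at the end of a move into it. With at least two fibers
-- each one is entered infinitely often, and a schedule gives every vertex its turn infinitely often
-- (`Simulates.exists_run`).
--
-- Since the formula is universal and guards survive contraction, truth in the contracted topologies
-- gives truth in `G`, and induction on the size reduces everything to topologies up to the cutoff.
-- In a ring with more than `2 * k` vertices two neighbors are unselected and can be merged. In a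
-- clique or star with more than `k + 1` vertices any two unselected vertices can be merged.
--
-- For decidability only the finitely many topologies of size at most `2 * k + 2` have to be
-- checked. Their model checking is written as an arithmetical statement with bounded quantifiers
-- only: finite sets are bit masks, the truth values of state formulas form a guessed table that is
-- verified locally, and `E ψ` asks for a set of tableau nodes in which every fairness condition and
-- every until eventuality stays reachable. Such a statement is primitive recursive, and its
-- correctness is `Represents.check_iff`.

theorem exists_path_of_transGen {X : Type*} {r : X → X → Prop} {x y : X}
    (h : Relation.TransGen r x y) :
    ∃ (l : ℕ) (p : ℕ → X), p 0 = x ∧ p (l + 1) = y ∧ ∀ i ≤ l, r (p i) (p (i + 1)) := by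
  induction h with
  | single h => exact ⟨0, fun i => if i = 0 then x else _, by simp, by simp; rfl, by simpa using h⟩
  | @tail b c _ hbc ih =>
    obtain ⟨l, p, h0, hl, hp⟩ := ih
    refine ⟨l + 1, fun i => if i ≤ l + 1 then p i else c, by simpa, by simp, ?_⟩
    intro i hi
    rcases Nat.lt_or_eq_of_le hi with hi | rfl
    · have h1 : i ≤ l + 1 := by omega
      have h2 : i + 1 ≤ l + 1 := by omega
      simpa [h1, h2] using hp i (by omega)
    · simpa [hl] using hbc

/-- Finite nonempty paths from `p m` to `p (m + 1)` concatenate to an infinite path. -/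
theorem exists_seq_of_transGen {X : Type*} {r : X → X → Prop} (p : ℕ → X)
    (h : ∀ m, Relation.TransGen r (p m) (p (m + 1))) :
    ∃ (x : ℕ → X) (t : ℕ → ℕ), StrictMono t ∧ x 0 = p 0 ∧ (∀ m, x (t m) = p m) ∧
      ∀ n, r (x n) (x (n + 1)) := by
  choose l w h0 hl hw using fun m => exists_path_of_transGen (h m)
  -- A position is a pair of a block and an offset in it. The endpoint of block `m` is represented
  -- as offset `0` of block `m + 1`, so offsets stop at `l m`.
  let next : ℕ × ℕ → ℕ × ℕ := fun s => if s.2 < l s.1 then (s.1, s.2 + 1) else (s.1 + 1, 0)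
  let st : ℕ → ℕ × ℕ := fun n => next^[n] (0, 0)
  have hst : ∀ n, st (n + 1) = next (st n) := fun n => Function.iterate_succ_apply' _ _ _
  have hle : ∀ n, (st n).2 ≤ l (st n).1 := by
    intro n
    induction n with
    | zero => exact Nat.zero_le _
    | succ n ih =>
      rw [hst]
      by_cases hc : (st n).2 < l (st n).1
      · simp [next, hc]
      · simp [next, hc]
  let t : ℕ → ℕ := fun m => Nat.rec 0 (fun m s => s + (l m + 1)) m
  have ht : ∀ m, t (m + 1) = t m + (l m + 1) := fun m => rfl
  have key : ∀ m, st (t m) = (m, 0) := by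
    intro m
    induction m with
    | zero => rfl
    | succ m ih =>
      have : ∀ i ≤ l m, st (t m + i) = (m, i) := by
        intro i hi
        induction i with
        | zero => exact ih
        | succ i ih' =>
          rw [← Nat.add_assoc, hst, ih' (by omega)]
          have : i < l m := by omega
          simp [next, this]
      rw [ht, ← Nat.add_assoc, hst, this _ le_rfl]
      simp [next]
  refine ⟨fun n => w (st n).1 (st n).2, t, strictMono_nat_of_lt_succ fun m => ?_, h0 0,
    fun m => ?_, fun n => ?_⟩
  · rw [ht]; omega
  · simp [key, h0]
  · have := hw (st n).1 (st n).2 (hle n)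
    simp only [hst]
    by_cases hc : (st n).2 < l (st n).1
    · simpa [next, hc] using this
    · have he : (st n).2 = l (st n).1 := le_antisymm (hle n) (not_lt.1 hc)
      simp only [next, hc, if_false, h0]
      rw [he, hl] at this
      rwa [he]

/-- An infinite set of times can be distributed so that every value is taken infinitely often. -/
theorem exists_schedule {X : Type*} [Nonempty X] [Countable X] {E : ℕ → Prop}
    (hE : ∃ᶠ m in Filter.atTop, E m) :
    ∃ f : ℕ → X, ∀ x, ∃ᶠ m in Filter.atTop, E m ∧ f m = x := by
  classical
  obtain ⟨e, he⟩ := exists_surjective_nat X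
  have hinf : (Set.ofPred E).Infinite := Nat.frequently_atTop_iff_infinite.1 hE
  -- The `n`-th event receives the value coded by the first component of `n.unpair`. The events
  -- numbered `Nat.pair r N`, for all `N`, therefore all receive the value `e r`.
  refine ⟨fun m => e (Nat.unpair (Nat.count E m)).1, fun x => ?_⟩
  obtain ⟨r, rfl⟩ := he x
  refine Filter.frequently_atTop.2 fun N => ?_
  refine ⟨Nat.nth E (Nat.pair r N), ?_, Nat.nth_mem_of_infinite hinf _, ?_⟩
  · exact (Nat.right_le_pair r N).trans ((Nat.nth_strictMono hinf).id_le _)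
  · simp [Nat.count_nth_of_infinite hinf]

/-! ## Stuttering -/

/-- A sequence of indices that starts at `0`, grows by at most one in each step, and is
unbounded. -/
structure Staircase (a : ℕ → ℕ) : Prop where
  zero : a 0 = 0
  step : ∀ n, a (n + 1) = a n ∨ a (n + 1) = a n + 1
  surj : ∀ j, ∃ n, a n = j

theorem Staircase.monotone {a : ℕ → ℕ} (h : Staircase a) : Monotone a :=
  monotone_nat_of_le_succ fun n => by rcases h.step n with h | h <;> omega

/-- A discrete intermediate value argument: at the first index where the value is at least `j + 1`
it cannot have overshot. -/
theorem Staircase.of_frequently {a : ℕ → ℕ} (zero : a 0 = 0)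
    (step : ∀ n, a (n + 1) = a n ∨ a (n + 1) = a n + 1) (unb : ∀ j, ∃ n, j ≤ a n) :
    Staircase a := by
  refine ⟨zero, step, fun j => ?_⟩
  induction j with
  | zero => exact ⟨0, zero⟩
  | succ j ih =>
    classical
    let n := Nat.find (unb (j + 1))
    have hn : j + 1 ≤ a n := Nat.find_spec (unb (j + 1))
    rcases hn0 : n with _ | m
    · rw [hn0, zero] at hn; omega
    · have hm : ¬ j + 1 ≤ a m := Nat.find_min (unb (j + 1)) (show m < n by omega)
      refine ⟨m + 1, ?_⟩
      rw [hn0] at hn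
      rcases step m with h | h <;> omega

theorem Staircase.suffix {a : ℕ → ℕ} (h : Staircase a) (n : ℕ) :
    Staircase fun i => a (n + i) - a n := by
  refine .of_frequently (by simp) (fun i => ?_) fun j => ?_
  · have := h.monotone (Nat.le_add_right n i)
    rcases h.step (n + i) with h | h <;> rw [← Nat.add_assoc, h] <;> omega
  · obtain ⟨m, hm⟩ := h.surj (a n + j)
    refine ⟨m, ?_⟩
    have := h.monotone (Nat.le_add_left m n)
    omega

/-- The first index at which a staircase has a given value. -/
theorem Staircase.exists_first {a : ℕ → ℕ} (h : Staircase a) (j : ℕ) :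
    ∃ n, a n = j ∧ ∀ m < n, a m < j := by
  classical
  refine ⟨Nat.find (h.surj j), Nat.find_spec (h.surj j), fun m hm => ?_⟩
  refine lt_of_le_of_ne ?_ (Nat.find_min (h.surj j) hm)
  exact (h.monotone hm.le).trans (Nat.find_spec (h.surj j)).le

/-- The paths `π` and `π'` agree up to stuttering and `R`. -/
def Align {S S' : Type*} (R : S → S' → Prop) (π : ℕ → S) (π' : ℕ → S') : Prop :=
  ∃ a b : ℕ → ℕ, Staircase a ∧ Staircase b ∧ ∀ n, R (π (a n)) (π' (b n))

theorem Align.symm {S S' : Type*} {R : S → S' → Prop} {π : ℕ → S} {π' : ℕ → S'}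
    (h : Align R π π') : Align (fun s' s => R s s') π' π := by
  obtain ⟨a, b, ha, hb, h⟩ := h
  exact ⟨b, a, hb, ha, h⟩

theorem Align.mono {S S' : Type*} {R R' : S → S' → Prop} {π : ℕ → S} {π' : ℕ → S'}
    (h : Align R π π') (hR : ∀ s s', R s s' → R' s s') : Align R' π π' := by
  obtain ⟨a, b, ha, hb, h⟩ := h
  exact ⟨a, b, ha, hb, fun n => hR _ _ (h n)⟩

theorem Align.head {S S' : Type*} {R : S → S' → Prop} {π : ℕ → S} {π' : ℕ → S'}
    (h : Align R π π') : R (π 0) (π' 0) := by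
  obtain ⟨a, b, ha, hb, h⟩ := h
  simpa [ha.zero, hb.zero] using h 0

/-- Each suffix on the left is matched on the right, so that the earlier suffixes on the right are
matched by earlier ones on the left. -/
theorem Align.exists_suffix {S S' : Type*} {R : S → S' → Prop} {π : ℕ → S} {π' : ℕ → S'}
    (h : Align R π π') (j : ℕ) :
    ∃ j', Align R (fun n => π (j + n)) (fun n => π' (j' + n)) ∧
      ∀ i' < j', ∃ i < j, Align R (fun n => π (i + n)) (fun n => π' (i' + n)) := by
  obtain ⟨a, b, ha, hb, h⟩ := h
  have suff : ∀ n, Align R (fun i => π (a n + i)) (fun i => π' (b n + i)) := fun n =>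
    ⟨_, _, ha.suffix n, hb.suffix n, fun i => by
      have h1 := ha.monotone (Nat.le_add_right n i)
      have h2 := hb.monotone (Nat.le_add_right n i)
      simpa [Nat.add_sub_cancel' h1, Nat.add_sub_cancel' h2] using h (n + i)⟩
  -- The first such `n` is needed: every earlier common time `m` then has `a m < j`, which provides
  -- the earlier matching suffix on the left.
  obtain ⟨n, rfl, hn⟩ := ha.exists_first j
  refine ⟨b n, suff n, fun i' hi' => ?_⟩
  obtain ⟨m, rfl⟩ := hb.surj i'
  have hm : m < n := by
    by_contra hc
    exact absurd (hb.monotone (not_lt.1 hc)) (by omega)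
  exact ⟨a m, hn m hm, suff m⟩

-- CTL* without next is invariant under fair stuttering bisimulation.

section Congr

variable {AP AP₁ AP₂ : Type*} {S₁ S₂ A₁ A₂ : Type*} {M₁ : LTS AP₁ S₁ A₁} {M₂ : LTS AP₂ S₂ A₂}
  {F₁ : Set (ℕ → S₁)} {F₂ : Set (ℕ → S₂)} {f₁ : AP → AP₁} {f₂ : AP → AP₂} {R : S₁ → S₂ → Prop}

mutual
/-- States related by a fair stuttering bisimulation satisfy the same state formulas. -/
theorem satState_congr
    (hl : ∀ s s', R s s' → ∀ p, f₁ p ∈ M₁.label s ↔ f₂ p ∈ M₂.label s')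
    (h₁ : ∀ s s', R s s' → ∀ π, M₁.IsPath π → π ∈ F₁ → π 0 = s →
      ∃ π', M₂.IsPath π' ∧ π' ∈ F₂ ∧ π' 0 = s' ∧ Align R π π')
    (h₂ : ∀ s s', R s s' → ∀ π', M₂.IsPath π' → π' ∈ F₂ → π' 0 = s' →
      ∃ π, M₁.IsPath π ∧ π ∈ F₁ ∧ π 0 = s ∧ Align R π π') :
    ∀ (φ : StateFormula AP) (s : S₁) (s' : S₂), R s s' →
      (M₁.SatState F₁ (φ.map f₁) s ↔ M₂.SatState F₂ (φ.map f₂) s')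
  | .tt, s, s', h => by simp [StateFormula.map, LTS.SatState]
  | .atom p, s, s', h => by simpa [StateFormula.map, LTS.SatState] using hl s s' h p
  | .neg φ, s, s', h => by
    simpa [StateFormula.map, LTS.SatState] using not_congr (satState_congr hl h₁ h₂ φ s s' h)
  | .and φ χ, s, s', h => by
    simpa [StateFormula.map, LTS.SatState] using
      and_congr (satState_congr hl h₁ h₂ φ s s' h) (satState_congr hl h₁ h₂ χ s s' h)
  | .ex ψ, s, s', h => by
    simp only [StateFormula.map, LTS.SatState]
    constructor
    · rintro ⟨π, hp, hf, h0, hs⟩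
      obtain ⟨π', hp', hf', h0', ha⟩ := h₁ s s' h π hp hf h0
      exact ⟨π', hp', hf', h0', (satPath_congr hl h₁ h₂ ψ π π' ha).1 hs⟩
    · rintro ⟨π, hp, hf, h0, hs⟩
      obtain ⟨π', hp', hf', h0', ha⟩ := h₂ s s' h π hp hf h0
      exact ⟨π', hp', hf', h0', (satPath_congr hl h₁ h₂ ψ π' π ha).2 hs⟩
/-- Paths that agree up to stuttering and a fair stuttering bisimulation satisfy the same path
formulas. -/
theorem satPath_congr
    (hl : ∀ s s', R s s' → ∀ p, f₁ p ∈ M₁.label s ↔ f₂ p ∈ M₂.label s')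
    (h₁ : ∀ s s', R s s' → ∀ π, M₁.IsPath π → π ∈ F₁ → π 0 = s →
      ∃ π', M₂.IsPath π' ∧ π' ∈ F₂ ∧ π' 0 = s' ∧ Align R π π')
    (h₂ : ∀ s s', R s s' → ∀ π', M₂.IsPath π' → π' ∈ F₂ → π' 0 = s' →
      ∃ π, M₁.IsPath π ∧ π ∈ F₁ ∧ π 0 = s ∧ Align R π π') :
    ∀ (ψ : PathFormula AP) (π : ℕ → S₁) (π' : ℕ → S₂), Align R π π' →
      (M₁.SatPath F₁ (ψ.map f₁) π ↔ M₂.SatPath F₂ (ψ.map f₂) π')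
  | .state φ, π, π', h => by
    simpa [PathFormula.map, LTS.SatPath] using satState_congr hl h₁ h₂ φ _ _ h.head
  | .neg ψ, π, π', h => by
    simpa [PathFormula.map, LTS.SatPath] using not_congr (satPath_congr hl h₁ h₂ ψ π π' h)
  | .and ψ χ, π, π', h => by
    simpa [PathFormula.map, LTS.SatPath] using
      and_congr (satPath_congr hl h₁ h₂ ψ π π' h) (satPath_congr hl h₁ h₂ χ π π' h)
  | .untl ψ χ, π, π', h => by
    simp only [PathFormula.map, LTS.SatPath]
    constructor
    · rintro ⟨j, hj, hi⟩
      obtain ⟨j', ha, hb⟩ := h.exists_suffix j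
      refine ⟨j', (satPath_congr hl h₁ h₂ χ _ _ ha).1 hj, fun i' hi' => ?_⟩
      obtain ⟨i, hij, hai⟩ := hb i' hi'
      exact (satPath_congr hl h₁ h₂ ψ _ _ hai).1 (hi i hij)
    · rintro ⟨j, hj, hi⟩
      obtain ⟨j', ha, hb⟩ := h.symm.exists_suffix j
      refine ⟨j', (satPath_congr hl h₁ h₂ χ _ _ ha.symm).2 hj, fun i' hi' => ?_⟩
      obtain ⟨i, hij, hai⟩ := hb i' hi'
      exact (satPath_congr hl h₁ h₂ ψ _ _ hai.symm).2 (hi i hij)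
end

end Congr

end TokenPassing

namespace TokenPassing

open Relation Function

/-! ## Processes can always exchange the token -/

namespace ProcessTemplate

variable {Q : Type u} {A : Type v} (P : ProcessTemplate Q A)

/-- Internal transitions of a process. -/
def IntStep (q q' : Q) : Prop := ∃ a, P.trans q (.int a) q'

variable {P}

theorem IntStep.token_iff {q q' : Q} (h : ReflTransGen P.IntStep q q') :
    q ∈ P.token ↔ q' ∈ P.token := by
  induction h with
  | refl => rfl
  | tail _ h ih =>
    obtain ⟨a, h⟩ := h
    exact ih.trans (P.trans_int _ _ _ h)

variable (P)

/-- By totality some infinite path starts in `q`. Its label sequence alternates, so it contains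
non-internal letters, and all steps before the first of them, at position `f 0`, are internal. -/
theorem exists_exchange (q : Q) :
    ∃ q' q'', ReflTransGen P.IntStep q q' ∧ (P.trans q' .snd q'' ∨ P.trans q' .rcv q'') := by
  choose σ nxt h using P.total
  let π : ℕ → Q := fun n => nxt^[n] q
  have hπ : ∀ n, P.trans (π n) (σ (π n)) (π (n + 1)) := fun n => by
    have : π (n + 1) = nxt (π n) := iterate_succ_apply' _ _ _
    rw [this]; exact h _
  obtain ⟨f, hf, hr, hs⟩ := P.alternates π (fun n => σ (π n)) hπ
  have hint : ∀ i ≤ f 0, ReflTransGen P.IntStep q (π i) := by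
    intro i hi
    induction i with
    | zero => exact .refl
    | succ i ih =>
      refine (ih (by omega)).tail ?_
      obtain ⟨a, ha⟩ := (hr i).1 (by
        rintro ⟨j, rfl⟩
        have := hf.monotone (Nat.zero_le j)
        omega)
      exact ⟨a, ha ▸ hπ i⟩
  refine ⟨π (f 0), π (f 0 + 1), hint _ le_rfl, ?_⟩
  have h0 := hπ (f 0)
  rcases hs with hs | hs
  · have e : σ (π (f 0)) = .snd := (hs 0).1
    left; rwa [e] at h0
  · have e : σ (π (f 0)) = .rcv := (hs 0).1
    right; rwa [e] at h0

theorem exists_snd {q : Q} (hq : q ∈ P.token) :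
    ∃ q' q'', ReflTransGen P.IntStep q q' ∧ P.trans q' .snd q'' := by
  obtain ⟨q', q'', h, h' | h'⟩ := P.exists_exchange q
  · exact ⟨q', q'', h, h'⟩
  · exact absurd ((IntStep.token_iff h).1 hq) (P.trans_rcv _ _ h').1

theorem exists_rcv {q : Q} (hq : q ∉ P.token) :
    ∃ q' q'', ReflTransGen P.IntStep q q' ∧ P.trans q' .rcv q'' := by
  obtain ⟨q', q'', h, h' | h'⟩ := P.exists_exchange q
  · exact absurd ((IntStep.token_iff h).2 (P.trans_snd _ _ h').1) hq
  · exact ⟨q', q'', h, h'⟩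

/-- In the global state `s`, exactly the process at `v` has the token. -/
def OneTok {V : Type*} (s : V → Q) (v : V) : Prop := ∀ j, s j ∈ P.token ↔ j = v

variable {P}

theorem OneTok.unique {V : Type*} {s : V → Q} {v w : V} (h : P.OneTok s v)
    (h' : P.OneTok s w) : v = w :=
  (h' v).1 ((h v).2 rfl)

theorem OneTok.update {V : Type*} [DecidableEq V] {s : V → Q} {v i : V} {q : Q}
    (h : P.OneTok s v) (hq : s i ∈ P.token ↔ q ∈ P.token) :
    P.OneTok (Function.update s i q) v := by
  intro j
  by_cases hj : j = i
  · subst hj; simpa [← hq] using h j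
  · simpa [hj] using h j

end ProcessTemplate

-- Steps of a token-passing system and the position of the token.

section Step

variable {Q : Type u} {A : Type v} (P : ProcessTemplate Q A) (G : Topology)

/-- The transitions of a token-passing system, without their labels. -/
def SysStep (s s' : Fin G.size → Q) : Prop := ∃ σ, (system P G).trans s σ s'

/-- A step in which the token goes from `v` to `w`. -/
structure TokStep (s s' : Fin G.size → Q) (v w : Fin G.size) : Prop where
  edge : G.edge v w
  snd : P.trans (s v) .snd (s' v)
  rcv : P.trans (s w) .rcv (s' w)
  rest : ∀ l, l ≠ v → l ≠ w → s' l = s l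

variable {P G}

theorem SysStep.cases {s s' : Fin G.size → Q} (h : SysStep P G s s') :
    (∃ i, P.IntStep (s i) (s' i) ∧ ∀ j, j ≠ i → s j = s' j) ∨ ∃ v w, TokStep P G s s' v w := by
  obtain ⟨σ | _, h⟩ := h
  · obtain ⟨i, h, h'⟩ := h
    exact .inl ⟨i, ⟨_, h⟩, h'⟩
  · obtain ⟨v, w, h1, h2, h3, h4⟩ := h
    exact .inr ⟨v, w, h1, h2, h3, h4⟩

theorem TokStep.sysStep {s s' : Fin G.size → Q} {v w : Fin G.size}
    (h : TokStep P G s s' v w) : SysStep P G s s' :=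
  ⟨.tok, v, w, h.edge, h.snd, h.rcv, h.rest⟩

theorem sysStep_update {s : Fin G.size → Q} {i : Fin G.size} {q : Q}
    (h : P.IntStep (s i) q) : SysStep P G s (update s i q) := by
  obtain ⟨a, h⟩ := h
  exact ⟨.int a, i, by simpa using h, fun j hj => by simp [hj]⟩

theorem TokStep.oneTok {s s' : Fin G.size → Q} {v w x : Fin G.size}
    (h : TokStep P G s s' v w) (hs : P.OneTok s x) : v = x ∧ P.OneTok s' w := by
  obtain rfl := (hs v).1 (P.trans_snd _ _ h.snd).1
  refine ⟨rfl, fun j => ?_⟩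
  by_cases hj : j = w
  · simpa [hj] using (P.trans_rcv _ _ h.rcv).2
  · by_cases hj' : j = v
    · subst hj'
      simpa [hj] using (P.trans_snd _ _ h.snd).2
    · rw [h.rest j hj' hj, hs j]; simp [hj, hj']

theorem oneTok_of_int {s s' : Fin G.size → Q} {i x : Fin G.size}
    (h : P.IntStep (s i) (s' i)) (h' : ∀ j, j ≠ i → s j = s' j) (hs : P.OneTok s x) :
    P.OneTok s' x := by
  intro j
  rw [← hs j]
  by_cases hj : j = i
  · subst hj; exact (ProcessTemplate.IntStep.token_iff (.single h)).symm
  · rw [h' j hj]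

theorem SysStep.exists_oneTok {s s' : Fin G.size → Q} {x : Fin G.size}
    (h : SysStep P G s s') (hs : P.OneTok s x) : ∃ y, P.OneTok s' y := by
  rcases h.cases with ⟨i, h, h'⟩ | ⟨v, w, h⟩
  · exact ⟨x, oneTok_of_int h h' hs⟩
  · exact ⟨w, (h.oneTok hs).2⟩

end Step

/-! ## Simulation of token-passing systems over a common graph of classes -/

/-- Edges between vertices of the same class. -/
def ClassEdge (G : Topology) {C : Type*} (c : Fin G.size → C) (v w : Fin G.size) : Prop :=
  G.edge v w ∧ c v = c w

/-- The vertices of `G₁` and `G₂` are grouped into common classes such that the selected vertices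
are alone in their classes. The token moves of `G₁` follow the edges between classes, and in `G₂`
the token can be moved along such an edge to every vertex of the next class. -/
structure Simulates (G₁ G₂ : Topology) {C I : Type*} (E : C → C → Prop) (c₁ : Fin G₁.size → C)
    (c₂ : Fin G₂.size → C) (g₁ : I → Fin G₁.size) (g₂ : I → Fin G₂.size) : Prop where
  fiber₁ : ∀ r v, c₁ v = c₁ (g₁ r) → v = g₁ r
  fiber₂ : ∀ r v, c₂ v = c₂ (g₂ r) → v = g₂ r
  sel : ∀ r, c₁ (g₁ r) = c₂ (g₂ r)
  surj₁ : Surjective c₁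
  surj₂ : Surjective c₂
  proj : ∀ v w, G₁.edge v w → c₁ v ≠ c₁ w → E (c₁ v) (c₁ w)
  lift : ∀ v t, E (c₂ v) (c₂ t) → ∃ w t', ReflTransGen (ClassEdge G₂ c₂) v w ∧ G₂.edge w t' ∧
    ReflTransGen (ClassEdge G₂ c₂) t' t

theorem ClassEdge.class_eq {G : Topology} {C : Type*} {c : Fin G.size → C} {v w : Fin G.size}
    (h : ReflTransGen (ClassEdge G c) v w) : c v = c w := by
  induction h with
  | refl => rfl
  | tail _ h ih => exact ih.trans h.2

section Simulation

variable {Q : Type u} {A : Type v} (P : ProcessTemplate Q A) {G₁ G₂ : Topology} {C I : Type*}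
  (c₁ : Fin G₁.size → C) (c₂ : Fin G₂.size → C) (g₁ : I → Fin G₁.size) (g₂ : I → Fin G₂.size)

/-- The selected processes are in the same states, and the token is in the same class. -/
def SimRel (s : Fin G₁.size → Q) (u : Fin G₂.size → Q) : Prop :=
  (∃ v w, P.OneTok s v ∧ P.OneTok u w ∧ c₁ v = c₂ w) ∧ ∀ r, s (g₁ r) = u (g₂ r)

/-- Steps of `G₂` that lead to a state related to `s`. -/
def StutterStep (s : Fin G₁.size → Q) (u u' : Fin G₂.size → Q) : Prop :=
  SysStep P G₂ u u' ∧ SimRel P c₁ c₂ g₁ g₂ s u'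

variable {P c₁ c₂ g₁ g₂}

theorem SimRel.class_eq {s : Fin G₁.size → Q} {u : Fin G₂.size → Q} {v : Fin G₁.size}
    {w : Fin G₂.size} (h : SimRel P c₁ c₂ g₁ g₂ s u) (hs : P.OneTok s v) (hu : P.OneTok u w) :
    c₁ v = c₂ w := by
  obtain ⟨⟨v', w', hv, hw, e⟩, -⟩ := h
  rwa [hs.unique hv, hu.unique hw]

theorem SimRel.exists_oneTok {s : Fin G₁.size → Q} {u : Fin G₂.size → Q}
    (h : SimRel P c₁ c₂ g₁ g₂ s u) : ∃ w, P.OneTok u w :=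
  let ⟨⟨_, w, _, hw, _⟩, _⟩ := h
  ⟨w, hw⟩

theorem SimRel.of_stutter {s : Fin G₁.size → Q} {u u' : Fin G₂.size → Q}
    (h : SimRel P c₁ c₂ g₁ g₂ s u) (hu : ReflTransGen (StutterStep P c₁ c₂ g₁ g₂ s) u u') :
    SimRel P c₁ c₂ g₁ g₂ s u' := by
  cases hu with
  | refl => exact h
  | tail _ h => exact h.2

/-- Unselected processes can make internal steps unnoticed. -/
theorem SimRel.int_steps {s : Fin G₁.size → Q} {u : Fin G₂.size → Q}
    (h : SimRel P c₁ c₂ g₁ g₂ s u) {i : Fin G₂.size} (hi : ∀ r, g₂ r ≠ i) {q : Q}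
    (hq : ReflTransGen P.IntStep (u i) q) :
    ReflTransGen (StutterStep P c₁ c₂ g₁ g₂ s) u (update u i q) := by
  induction hq with
  | refl => simpa using ReflTransGen.refl
  | @tail q q' hq hs ih =>
    refine ih.tail ⟨?_, ?_, fun r => ?_⟩
    · have := sysStep_update (G := G₂) (s := update u i q) (i := i) (q := q') (by simpa using hs)
      simpa using this
    · obtain ⟨⟨v, w, hv, hw, e⟩, -⟩ := h
      exact ⟨v, w, hv, hw.update (ProcessTemplate.IntStep.token_iff (hq.tail hs)), e⟩
    · simpa [hi r] using h.2 r

theorem TokStep.of_update {G : Topology} {u : Fin G.size → Q} {w w' : Fin G.size} {q q' : Q}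
    (he : G.edge w w') (hs : P.trans (u w) .snd q) (hr : P.trans (u w') .rcv q') :
    TokStep P G u (update (update u w q) w' q') w w' := by
  have hne : w ≠ w' := by rintro rfl; exact G.irrefl _ he
  refine ⟨he, ?_, ?_, fun l h1 h2 => ?_⟩
  · simpa [hne] using hs
  · simpa using hr
  · simp [h1, h2]

variable {E : C → C → Prop}

/-- The token can be moved within a class unnoticed. -/
theorem Simulates.move_within (H : Simulates G₁ G₂ E c₁ c₂ g₁ g₂) {s : Fin G₁.size → Q}
    {u : Fin G₂.size → Q} (h : SimRel P c₁ c₂ g₁ g₂ s u) {w w' : Fin G₂.size}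
    (hw : P.OneTok u w) (hc : ReflTransGen (ClassEdge G₂ c₂) w w') :
    ∃ u', ReflTransGen (StutterStep P c₁ c₂ g₁ g₂ s) u u' ∧ P.OneTok u' w' := by
  induction hc with
  | refl => exact ⟨u, .refl, hw⟩
  | @tail x y _ hxy ih =>
    obtain ⟨u₀, hu, hx⟩ := ih
    have h₀ := h.of_stutter hu
    have hne : x ≠ y := by rintro rfl; exact G₂.irrefl _ hxy.1
    -- An edge inside a class joins two distinct vertices of that class, so neither can be selected.
    -- Both may prepare for the exchange by internal steps without being noticed.
    have hgx : ∀ r, g₂ r ≠ x := fun r e => hne (e ▸ H.fiber₂ r y (e ▸ hxy.2.symm)).symm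
    have hgy : ∀ r, g₂ r ≠ y := fun r e => hne (e ▸ H.fiber₂ r x (e ▸ hxy.2))
    obtain ⟨q, q', hq, hsnd⟩ := P.exists_snd ((hx x).2 rfl)
    have h1 := h₀.int_steps hgx hq
    have hy : update u₀ x q y ∉ P.token := by
      simpa [hne.symm] using fun hy => hne ((hx y).1 hy).symm
    obtain ⟨p, p', hp, hrcv⟩ := P.exists_rcv hy
    have h2 := (h₀.of_stutter h1).int_steps hgy hp
    have hx2 : P.OneTok (update (update u₀ x q) y p) x :=
      (hx.update (ProcessTemplate.IntStep.token_iff hq)).update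
        (ProcessTemplate.IntStep.token_iff hp)
    have ht := TokStep.of_update (P := P) (u := update (update u₀ x q) y p) (q := q') (q' := p')
      hxy.1 (by simpa [hne] using hsnd) (by simpa using hrcv)
    have hy' := (ht.oneTok hx2).2
    refine ⟨_, ((hu.trans h1).trans h2).tail ⟨ht.sysStep, ?_, fun r => ?_⟩, hy'⟩
    · have h3 := (h₀.of_stutter h1).of_stutter h2
      obtain ⟨⟨v, w, hv, hw, e⟩, -⟩ := id h3
      exact ⟨v, y, hv, hy', by rw [h3.class_eq hv hx2, hxy.2]⟩
    · simpa [hgx r, hgy r] using h.2 r |>.trans (h.of_stutter hu |>.2 r |> fun e => by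
        rw [← e, h.2 r])

/-- A token move of `G₁` between two classes can be copied along an edge of `G₂`. -/
theorem Simulates.cross (H : Simulates G₁ G₂ E c₁ c₂ g₁ g₂) {s s' : Fin G₁.size → Q}
    {u : Fin G₂.size → Q} (h : SimRel P c₁ c₂ g₁ g₂ s u) {v v' : Fin G₁.size}
    {w w' : Fin G₂.size} (hs : P.OneTok s v) (hw : P.OneTok u w) (ht : TokStep P G₁ s s' v v')
    (hc : c₁ v' = c₂ w') (he : G₂.edge w w') :
    ∃ u₁ u', ReflTransGen (StutterStep P c₁ c₂ g₁ g₂ s) u u₁ ∧ SysStep P G₂ u₁ u' ∧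
      SimRel P c₁ c₂ g₁ g₂ s' u' ∧ P.OneTok u' w' := by
  have hne : w ≠ w' := by rintro rfl; exact G₂.irrefl _ he
  have hvw : c₁ v = c₂ w := h.class_eq hs hw
  -- `v` and `w` lie in the same class, and a selected vertex is alone in its class on either side;
  -- hence the same indices select both.
  have selv : ∀ r, g₂ r = w ↔ g₁ r = v := fun r =>
    ⟨fun e => (H.fiber₁ r v (by rw [hvw, H.sel, e])).symm,
      fun e => (H.fiber₂ r w (by rw [← hvw, ← H.sel, e])).symm⟩
  have selv' : ∀ r, g₂ r = w' ↔ g₁ r = v' := fun r =>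
    ⟨fun e => (H.fiber₁ r v' (by rw [hc, H.sel, e])).symm,
      fun e => (H.fiber₂ r w' (by rw [← hc, ← H.sel, e])).symm⟩
  -- A selected sender has the same local state as its counterpart and copies its send transition.
  -- An unselected one first makes internal steps to some state in which it can send.
  obtain ⟨u₁, q, h1, hw1, hq, hqr⟩ : ∃ u₁ q, ReflTransGen (StutterStep P c₁ c₂ g₁ g₂ s) u u₁ ∧
      P.OneTok u₁ w ∧ P.trans (u₁ w) .snd q ∧ ∀ r, g₂ r = w → q = s' (g₁ r) := by
    by_cases hsel : ∃ r, g₂ r = w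
    · obtain ⟨r, hr⟩ := hsel
      refine ⟨u, s' v, .refl, hw, ?_, fun r' hr' => by rw [(selv r').1 hr']⟩
      rw [← hr, ← h.2 r, (selv r).1 hr]
      exact ht.snd
    · simp only [not_exists] at hsel
      obtain ⟨q, q', hq, hsnd⟩ := P.exists_snd ((hw w).2 rfl)
      exact ⟨_, q', h.int_steps hsel hq, hw.update (ProcessTemplate.IntStep.token_iff hq),
        by simpa using hsnd, fun r hr => absurd hr (hsel r)⟩
  have h₁ := h.of_stutter h1
  -- The receiver is prepared likewise; `u₂ w = u₁ w` records that the sender remains ready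
  -- meanwhile.
  obtain ⟨u₂, q', h2, hw2, huw, hq', hqr'⟩ : ∃ u₂ q',
      ReflTransGen (StutterStep P c₁ c₂ g₁ g₂ s) u₁ u₂ ∧ P.OneTok u₂ w ∧ u₂ w = u₁ w ∧
      P.trans (u₂ w') .rcv q' ∧ ∀ r, g₂ r = w' → q' = s' (g₁ r) := by
    by_cases hsel : ∃ r, g₂ r = w'
    · obtain ⟨r, hr⟩ := hsel
      refine ⟨u₁, s' v', .refl, hw1, rfl, ?_, fun r' hr' => by rw [(selv' r').1 hr']⟩
      rw [← hr, ← h₁.2 r, (selv' r).1 hr]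
      exact ht.rcv
    · simp only [not_exists] at hsel
      obtain ⟨q, q', hq, hrcv⟩ := P.exists_rcv fun hm => hne ((hw1 w').1 hm).symm
      exact ⟨_, q', h₁.int_steps hsel hq, hw1.update (ProcessTemplate.IntStep.token_iff hq),
        by simp [hne], by simpa using hrcv, fun r hr => absurd hr (hsel r)⟩
  have h₂ := h₁.of_stutter h2
  have ht' := TokStep.of_update (P := P) he (huw ▸ hq) hq'
  have hw' := (ht'.oneTok hw2).2
  refine ⟨u₂, _, h1.trans h2, ht'.sysStep, ⟨⟨v', w', (ht.oneTok hs).2, hw', hc⟩, fun r => ?_⟩, hw'⟩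
  by_cases e' : g₂ r = w'
  · rw [e', update_self, hqr' r e']
  · by_cases e : g₂ r = w
    · rw [e, update_of_ne hne, update_self, hqr r e]
    · rw [update_of_ne e', update_of_ne e, ← h₂.2 r]
      exact ht.rest _ (fun h => e ((selv r).2 h)) (fun h => e' ((selv' r).2 h))

/-- Every step of `G₁` can be simulated by `G₂`; if it takes the token to another class, then the
vertex that has the token in the end can be chosen there. -/
theorem Simulates.step (H : Simulates G₁ G₂ E c₁ c₂ g₁ g₂) {s s' : Fin G₁.size → Q}
    {u : Fin G₂.size → Q} (h : SimRel P c₁ c₂ g₁ g₂ s u) (hs : SysStep P G₁ s s')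
    (t : Fin G₂.size) :
    ∃ u', SimRel P c₁ c₂ g₁ g₂ s' u' ∧
      (u' = u ∨ ∃ u₁ u₂, ReflTransGen (StutterStep P c₁ c₂ g₁ g₂ s) u u₁ ∧ SysStep P G₂ u₁ u₂ ∧
        SimRel P c₁ c₂ g₁ g₂ s' u₂ ∧ ReflTransGen (StutterStep P c₁ c₂ g₁ g₂ s') u₂ u') ∧
      ∀ v v', P.OneTok s v → P.OneTok s' v' → c₁ v ≠ c₁ v' → c₂ t = c₁ v' → u' t ∈ P.token := by
  obtain ⟨⟨x, w, hx, hw, hxw⟩, hsel⟩ := id h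
  rcases hs.cases with ⟨i, hi, hrest⟩ | ⟨v, v', ht⟩
  · have hx' := oneTok_of_int hi hrest hx
    -- An internal step does not move the token, so the clause about entering another class is
    -- vacuous.
    have hlast : ∀ u' : Fin G₂.size → Q, ∀ v v', P.OneTok s v → P.OneTok s' v' → c₁ v ≠ c₁ v' →
        c₂ t = c₁ v' → u' t ∈ P.token := fun u' v v' hv hv' hne =>
      absurd (congrArg c₁ ((hv.unique hx).trans (hx'.unique hv'))) hne
    by_cases hri : ∃ r, g₁ r = i
    · obtain ⟨r, rfl⟩ := hri
      have hI : P.IntStep (u (g₂ r)) (s' (g₁ r)) := by rwa [← hsel]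
      have hrel : SimRel P c₁ c₂ g₁ g₂ s' (update u (g₂ r) (s' (g₁ r))) := by
        refine ⟨⟨x, w, hx', hw.update (ProcessTemplate.IntStep.token_iff (.single hI)), hxw⟩,
          fun r' => ?_⟩
        by_cases e : g₂ r' = g₂ r
        · rw [e, update_self, H.fiber₁ r (g₁ r') (by rw [H.sel, e, ← H.sel])]
        · rw [update_of_ne e, ← hsel, hrest]
          exact fun e' => e (H.fiber₂ r (g₂ r') (by rw [← H.sel, e', H.sel]))
      exact ⟨_, hrel, .inr ⟨u, _, .refl, sysStep_update hI, hrel, .refl⟩, hlast _⟩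
    · simp only [not_exists] at hri
      exact ⟨u, ⟨⟨x, w, hx', hw, hxw⟩, fun r => by rw [← hsel, hrest _ (hri r)]⟩, .inl rfl,
        hlast _⟩
  · obtain ⟨rfl, hv'⟩ := ht.oneTok hx
    -- A token move inside a class involves only unselected processes and keeps the class of the
    -- token, so `G₂` answers by resting.
    by_cases hcc : c₁ v = c₁ v'
    · have hne : v ≠ v' := by rintro rfl; exact G₁.irrefl _ ht.edge
      refine ⟨u, ⟨⟨v', w, hv', hw, hcc ▸ hxw⟩, fun r => ?_⟩, .inl rfl, fun y y' hy hy' hn =>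
        absurd ?_ hn⟩
      · rw [← hsel, ht.rest]
        · rintro rfl; exact hne (H.fiber₁ r v' hcc.symm).symm
        · rintro rfl; exact hne (H.fiber₁ r v hcc)
      · rw [hy.unique hx, hy'.unique hv', hcc]
    · obtain ⟨t', ht', htt⟩ : ∃ t', c₂ t' = c₁ v' ∧ (c₂ t = c₁ v' → t' = t) := by
        by_cases e : c₂ t = c₁ v'
        · exact ⟨t, e, fun _ => rfl⟩
        · obtain ⟨t', ht'⟩ := H.surj₂ (c₁ v')
          exact ⟨t', ht', fun e' => absurd e' e⟩
      obtain ⟨w₁, t₁, hw₁, he, ht₁⟩ := H.lift w t' (by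
        rw [← hxw, ht']; exact H.proj _ _ ht.edge hcc)
      obtain ⟨u₁, hu₁, hw₁'⟩ := H.move_within h hw hw₁
      obtain ⟨u₂, u₃, h2, h3, h4, h5⟩ := H.cross (h.of_stutter hu₁) hx hw₁' ht
        (w' := t₁) (by rw [ClassEdge.class_eq ht₁, ht']) he
      obtain ⟨u₄, h6, h7⟩ := H.move_within h4 h5 ht₁
      refine ⟨u₄, h4.of_stutter h6, .inr ⟨u₂, u₃, hu₁.trans h2, h3, h4, h6⟩,
        fun y y' hy hy' hn e => ?_⟩
      rw [hy'.unique hv'] at e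
      rw [← htt e]
      exact (h7 t').2 rfl

/-- A transition of the product of a run `π` of `G₁` with `G₂`: positions in the two runs, and the
state of `G₂`. -/
def ProductStep (P : ProcessTemplate Q A) (c₁ : Fin G₁.size → C) (c₂ : Fin G₂.size → C)
    (g₁ : I → Fin G₁.size) (g₂ : I → Fin G₂.size) (π : ℕ → Fin G₁.size → Q)
    (x y : ℕ × ℕ × (Fin G₂.size → Q)) : Prop :=
  SimRel P c₁ c₂ g₁ g₂ (π y.1) y.2.2 ∧
    ((y.2.1 = x.2.1 + 1 ∧ SysStep P G₂ x.2.2 y.2.2 ∧ (y.1 = x.1 ∨ y.1 = x.1 + 1)) ∨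
      (y.1 = x.1 + 1 ∧ y.2 = x.2))

theorem ProductStep.of_stutter {π : ℕ → Fin G₁.size → Q} {m j : ℕ} {u u' : Fin G₂.size → Q}
    (h : ReflTransGen (StutterStep P c₁ c₂ g₁ g₂ (π m)) u u') :
    ∃ j' ≥ j, ReflTransGen (ProductStep P c₁ c₂ g₁ g₂ π) (m, j, u) (m, j', u') := by
  induction h with
  | refl => exact ⟨j, le_rfl, .refl⟩
  | tail _ h ih =>
    obtain ⟨j', hj, ih⟩ := ih
    exact ⟨j' + 1, by omega, ih.tail ⟨h.2, .inl ⟨rfl, h.1, .inl rfl⟩⟩⟩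

/-- Besides the requested position of the token, this records that entering another class costs at
least one genuine step of `G₂`. That is what prevents the simulating run from coming to a halt. -/
theorem Simulates.exists_productSteps (H : Simulates G₁ G₂ E c₁ c₂ g₁ g₂)
    {π : ℕ → Fin G₁.size → Q} {m j : ℕ} {u : Fin G₂.size → Q}
    (h : SimRel P c₁ c₂ g₁ g₂ (π m) u) (hs : SysStep P G₁ (π m) (π (m + 1)))
    (t : Fin G₂.size) :
    ∃ j' u', SimRel P c₁ c₂ g₁ g₂ (π (m + 1)) u' ∧
      TransGen (ProductStep P c₁ c₂ g₁ g₂ π) (m, j, u) (m + 1, j', u') ∧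
      ∀ v v', P.OneTok (π m) v → P.OneTok (π (m + 1)) v' → c₁ v ≠ c₁ v' → c₂ t = c₁ v' →
        u' t ∈ P.token ∧ j < j' := by
  obtain ⟨u', hu', hpath, htok⟩ := H.step h hs t
  rcases hpath with rfl | ⟨u₁, u₂, h1, h2, h3, h4⟩
  · refine ⟨j, u', hu', .single ⟨hu', .inr ⟨rfl, rfl⟩⟩, fun v v' hv hv' hn e => ?_⟩
    have ht := htok v v' hv hv' hn e
    obtain ⟨w, hw⟩ := h.exists_oneTok
    -- If `G₂` had rested, the token would have been at `t` already, and the classes before and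
    -- after the step of `G₁` would agree.
    obtain rfl := (hw t).1 ht
    exact absurd ((h.class_eq hv hw).trans e) hn
  · obtain ⟨j₁, hj₁, p₁⟩ := ProductStep.of_stutter (j := j) h1
    obtain ⟨j₂, hj₂, p₂⟩ := ProductStep.of_stutter (m := m + 1) (j := j₁ + 1) h4
    exact ⟨j₂, u', hu',
      (TransGen.tail' p₁ ⟨h3, .inl ⟨rfl, h2, .inr rfl⟩⟩).trans_left p₂,
      fun v v' hv hv' hn e => ⟨htok v v' hv hv' hn e, by omega⟩⟩

/-- With only one class there would be no entries at all. If there is another class, it is visited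
at some late time, and the next visit to `b` must be preceded by an entry into `b`. -/
theorem frequently_enter {C : Type*} [Nontrivial C] {f : ℕ → C}
    (h : ∀ b, ∃ᶠ m in Filter.atTop, f m = b) (b : C) :
    ∃ᶠ m in Filter.atTop, f m ≠ b ∧ f (m + 1) = b := by
  refine Filter.frequently_atTop.2 fun N => ?_
  by_contra! hc
  obtain ⟨b', hb'⟩ := exists_ne b
  obtain ⟨m, hm, rfl⟩ := Filter.frequently_atTop.1 (h b') N
  have : ∀ i, f (m + i) ≠ b := by
    intro i
    induction i with
    | zero => exact hb'
    | succ i ih => exact hc (m + i) (by omega) ih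
  obtain ⟨n, hn, e⟩ := Filter.frequently_atTop.1 (h b) m
  exact this (n - m) (by rwa [Nat.add_sub_cancel' hn])

/-- Fair runs of `G₁` can be simulated by fair runs of `G₂`. -/
theorem Simulates.exists_run [Nontrivial C] (H : Simulates G₁ G₂ E c₁ c₂ g₁ g₂)
    {π : ℕ → Fin G₁.size → Q} {u₀ : Fin G₂.size → Q} (h₀ : SimRel P c₁ c₂ g₁ g₂ (π 0) u₀)
    (hπ : (system P G₁).IsPath π) (hf : π ∈ fairRuns P G₁) :
    ∃ π' : ℕ → Fin G₂.size → Q, (system P G₂).IsPath π' ∧ π' ∈ fairRuns P G₂ ∧ π' 0 = u₀ ∧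
      Align (SimRel P c₁ c₂ g₁ g₂) π π' := by
  have hpos : ∀ m, ∃ v, P.OneTok (π m) v := by
    intro m
    induction m with
    | zero => obtain ⟨⟨v, _, hv, _⟩, _⟩ := h₀; exact ⟨v, hv⟩
    | succ m ih =>
      obtain ⟨v, hv⟩ := ih
      exact SysStep.exists_oneTok (hπ m) hv
  choose pos hpos using hpos
  have hcls : ∀ b, ∃ᶠ m in Filter.atTop, c₁ (pos m) = b := fun b => by
    obtain ⟨v, rfl⟩ := H.surj₁ b
    exact (hf v).mono fun m hm => by rw [(hpos m v).1 hm]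
  have hent := frequently_enter hcls
  have : Nonempty (Fin G₂.size) := ⟨G₂.init⟩
  -- For each class `b`, the entries of the token into `b` are distributed over all vertices of
  -- `G₂`. An assigned vertex outside `b` imposes nothing, while each vertex of `b` is assigned to
  -- infinitely many entries.
  choose f hsched using fun b => exists_schedule (X := Fin G₂.size) (hent b)
  -- the successive states of the simulating run
  let X := {x : ℕ × ℕ × (Fin G₂.size → Q) // SimRel P c₁ c₂ g₁ g₂ (π x.1) x.2.2}
  have hnext : ∀ x : X, ∃ y : X, y.1.1 = x.1.1 + 1 ∧
      TransGen (ProductStep P c₁ c₂ g₁ g₂ π) x.1 y.1 ∧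
      (c₁ (pos x.1.1) ≠ c₁ (pos (x.1.1 + 1)) →
        c₂ (f (c₁ (pos (x.1.1 + 1))) x.1.1) = c₁ (pos (x.1.1 + 1)) →
        y.1.2.2 (f (c₁ (pos (x.1.1 + 1))) x.1.1) ∈ P.token ∧ x.1.2.1 < y.1.2.1) := by
    rintro ⟨⟨m, j, u⟩, hx⟩
    obtain ⟨j', u', hu', hp, ht⟩ :=
      H.exists_productSteps (j := j) hx (hπ m) (f (c₁ (pos (m + 1))) m)
    exact ⟨⟨(m + 1, j', u'), hu'⟩, rfl, hp, ht _ _ (hpos m) (hpos (m + 1))⟩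
  choose next hn1 hn2 hn3 using hnext
  let p : ℕ → X := fun m => next^[m] ⟨(0, 0, u₀), h₀⟩
  have hp : ∀ m, p (m + 1) = next (p m) := fun m => iterate_succ_apply' _ _ _
  have hp1 : ∀ m, (p m).1.1 = m := by
    intro m
    induction m with
    | zero => rfl
    | succ m ih => rw [hp, hn1, ih]
  obtain ⟨x, τ, hτ, hx0, hxp, hx⟩ := exists_seq_of_transGen (fun m => (p m).1)
    (fun m => by rw [hp]; exact hn2 _)
  have hx0' : x 0 = (0, 0, u₀) := hx0
  have hmono : Monotone fun n => (x n).2.1 := monotone_nat_of_le_succ fun n => by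
    rcases (hx n).2 with ⟨h, -⟩ | ⟨-, h⟩
    · omega
    · rw [h]
  -- each vertex gets the token at arbitrarily late positions
  have hvisit : ∀ t N, ∃ n ≥ N, (x n).2.2 t ∈ P.token ∧ (x N).2.1 < (x n).2.1 := by
    intro t N
    obtain ⟨m, hm, ⟨hne, he⟩, hft⟩ := Filter.frequently_atTop.1 (hsched (c₂ t) t) N
    have h4 := hn3 (p m)
    rw [hp1, he, hft, ← hp, ← hxp, ← hxp] at h4
    obtain ⟨h5, h6⟩ := h4 hne rfl
    have : N ≤ τ m := hm.trans (hτ.id_le m)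
    exact ⟨τ (m + 1), this.trans (hτ.monotone m.le_succ), h5, (hmono this).trans_lt h6⟩
  have ha : Staircase fun n => (x n).1 := by
    refine .of_frequently (by simp [hx0']) (fun n => ?_) fun j => ⟨τ j, by rw [hxp, hp1]⟩
    rcases (hx n).2 with ⟨-, -, h | h⟩ | ⟨h, -⟩ <;> simp [h]
  have hb : Staircase fun n => (x n).2.1 := by
    refine .of_frequently (by simp [hx0']) (fun n => ?_) fun j => ?_
    · rcases (hx n).2 with ⟨h, -⟩ | ⟨-, h⟩ <;> simp [h]
    · induction j with
      | zero => exact ⟨0, Nat.zero_le _⟩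
      | succ j ih =>
        obtain ⟨n, hn⟩ := ih
        obtain ⟨n', -, -, h⟩ := hvisit G₂.init n
        exact ⟨n', by omega⟩
  -- `d j` is the first product position at which `G₂` has made `j` steps. Reading the state of `G₂`
  -- at these positions removes the product steps in which it rests; `hd` says that nothing is lost,
  -- as its state depends only on the number of its steps.
  choose d hd1 hd2 using hb.exists_first
  have hd : ∀ n, (x n).2.2 = (x (d (x n).2.1)).2.2 := by
    intro n
    have hle : d (x n).2.1 ≤ n := by
      by_contra hc
      exact absurd (hd2 _ n (not_le.1 hc)) (lt_irrefl _)
    have : ∀ i, d (x n).2.1 + i ≤ n → (x (d (x n).2.1 + i)).2.2 = (x (d (x n).2.1)).2.2 := by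
      intro i
      induction i with
      | zero => simp
      | succ i ih =>
        intro hi
        rw [← ih (by omega)]
        rcases (hx (d (x n).2.1 + i)).2 with ⟨h, -⟩ | ⟨-, h⟩
        · have h1 := hmono hi
          have h2 := hmono (Nat.le_add_right (d (x n).2.1) i)
          have h3 := hd1 (x n).2.1
          simp only at h1 h2 h3
          rw [← Nat.add_assoc] at h1
          omega
        · rw [← Nat.add_assoc, h]
    have h := this (n - d (x n).2.1) (by omega)
    rwa [Nat.add_sub_cancel' hle] at h
  refine ⟨fun j => (x (d j)).2.2, fun j => ?_, fun t => ?_, ?_, _, _, ha, hb, fun n => ?_⟩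
  · rcases hn : d (j + 1) with _ | n
    · have := hd1 (j + 1)
      rw [hn, hx0'] at this
      simp at this
    -- At position `n` the step counter is still below `j + 1`, so the product step from `n` to `n +
    -- 1` is the step of `G₂` from `j` to `j + 1`.
    · have h1 := hd1 (j + 1)
      have h2 := hd2 (j + 1) n (by omega)
      rw [hn] at h1
      rcases (hx n).2 with ⟨h, h', -⟩ | ⟨-, h⟩
      · have e : (x n).2.1 = j := by omega
        have e' := hd n
        rw [e] at e'
        show SysStep P G₂ (x (d j)).2.2 (x (d (j + 1))).2.2
        rw [hn, ← e']
        exact h'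
      · rw [h] at h1; omega
  · refine Filter.frequently_atTop.2 fun N => ?_
    obtain ⟨n, hn⟩ := hb.surj N
    obtain ⟨n', hn', ht, hlt⟩ := hvisit t n
    exact ⟨(x n').2.1, by omega, by simpa only [← hd] using ht⟩
  · have := hd 0
    rw [hx0'] at this
    exact this.symm
  · show SimRel P c₁ c₂ g₁ g₂ (π (x n).1) (x (d (x n).2.1)).2.2
    rw [← hd]
    cases n with
    | zero => rw [hx0']; exact h₀
    | succ n => exact (hx n).1

end Simulation

/-! ## Contractions -/

/-- `c` maps the vertices of `G` onto those of `H`, so that each fiber is connected as far as token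
passing is concerned, and selected vertices are alone in their fibers. -/
structure Contraction (G H : Topology) {I : Type*} (g : I → Fin G.size)
    (c : Fin G.size → Fin H.size) : Prop where
  init : c G.init = H.init
  fiber : ∀ r v, c v = c (g r) → v = g r
  surj : Surjective c
  proj : ∀ v w, G.edge v w → c v ≠ c w → H.edge (c v) (c w)
  lift : ∀ v t, H.edge (c v) (c t) → ∃ w t', ReflTransGen (ClassEdge G c) v w ∧ G.edge w t' ∧
    ReflTransGen (ClassEdge G c) t' t

namespace Contraction

variable {G H : Topology} {I : Type*} {g : I → Fin G.size} {c : Fin G.size → Fin H.size}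

/-- The common classes are the vertices of `H`, with the identity as class map on `H`. In this
direction moves need no detour inside a class; in the converse direction the `lift` condition
supplies it. -/
theorem simulates (h : Contraction G H g c) :
    Simulates G H H.edge c id g (fun r => c (g r)) where
  fiber₁ := h.fiber
  fiber₂ _ _ e := e
  sel _ := rfl
  surj₁ := h.surj
  surj₂ := surjective_id
  proj := h.proj
  lift v t e := ⟨v, t, .refl, e, .refl⟩

theorem simulates_symm (h : Contraction G H g c) :
    Simulates H G H.edge id c (fun r => c (g r)) g where
  fiber₁ _ _ e := e
  fiber₂ := h.fiber
  sel _ := rfl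
  surj₁ := surjective_id
  surj₂ := h.surj
  proj _ _ e _ := e
  lift := h.lift

variable {Q : Type u} {A : Type v} {P : ProcessTemplate Q A}

theorem simRel_symm {s : Fin G.size → Q} {u : Fin H.size → Q} :
    SimRel P c id g (fun r => c (g r)) s u ↔ SimRel P id c (fun r => c (g r)) g u s :=
  ⟨fun ⟨⟨v, w, hv, hw, e⟩, h⟩ => ⟨⟨w, v, hw, hv, e.symm⟩, fun r => (h r).symm⟩,
    fun ⟨⟨v, w, hv, hw, e⟩, h⟩ => ⟨⟨w, v, hw, hv, e.symm⟩, fun r => (h r).symm⟩⟩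

/-- The two simulations make `SimRel` a fair stuttering bisimulation. Two vertices in `H` are
required so that the token keeps changing its class along a fair run. -/
theorem satState_iff {AP : Type*} (h : Contraction G H g c) (hH : 2 ≤ H.size)
    (φ : StateFormula AP) (a : AP → ℕ × I) {s : Fin G.size → Q} {u : Fin H.size → Q}
    (hsu : SimRel P c id g (fun r => c (g r)) s u) :
    (system P G).SatState (fairRuns P G) (φ.map fun x => ((a x).1, g (a x).2)) s ↔
      (system P H).SatState (fairRuns P H) (φ.map fun x => ((a x).1, c (g (a x).2))) u := by
  have : Nontrivial (Fin H.size) := Fin.nontrivial_iff_two_le.2 hH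
  refine satState_congr (R := SimRel P c id g (fun r => c (g r))) ?_ ?_ ?_ φ s u hsu
  · intro s u hsu p
    simp only [system, Set.mem_ofPred_eq]
    rw [hsu.2]
  · rintro _ u hsu π hp hf rfl
    exact h.simulates.exists_run hsu hp hf
  · rintro s _ hsu π hp hf rfl
    obtain ⟨π', h1, h2, h3, h4⟩ := h.simulates_symm.exists_run (simRel_symm.1 hsu) hp hf
    exact ⟨π', h1, h2, h3, h4.symm.mono fun _ _ => simRel_symm.2⟩

end Contraction

theorem ProcessTemplate.mem_init_iff {Q : Type u} {A : Type v} (P : ProcessTemplate Q A) {q : Q} :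
    q ∈ P.init ↔ (q ∈ P.token ∧ q = P.initTok) ∨ (q ∉ P.token ∧ q = P.initNon) := by
  rw [P.init_eq]
  constructor
  · rintro (rfl | rfl)
    · exact .inl ⟨P.initTok_mem, rfl⟩
    · exact .inr ⟨P.initNon_notMem, rfl⟩
  · rintro (⟨-, rfl⟩ | ⟨-, rfl⟩) <;> simp

theorem mem_system_init {Q : Type u} {A : Type v} {P : ProcessTemplate Q A} {G : Topology}
    {s : Fin G.size → Q} :
    s ∈ (system P G).init ↔ (∀ i, i = G.init → s i = P.initTok) ∧
      ∀ i, i ≠ G.init → s i = P.initNon := by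
  have h1 := P.initTok_mem
  have h2 := P.initNon_notMem
  constructor
  · refine fun h => ⟨fun i hi => ?_, fun i hi => ?_⟩
    · have := (P.mem_init_iff.1 (h i).1)
      have := (h i).2
      tauto
    · have := (P.mem_init_iff.1 (h i).1)
      have := (h i).2
      tauto
  · rintro ⟨h, h'⟩ i
    by_cases hi : i = G.init
    · rw [P.mem_init_iff, h i hi]; simp [h1, hi]
    · rw [P.mem_init_iff, h' i hi]; simp [h2, hi]

/-- An assignment that satisfies the guards in `G` still satisfies them after composition with `c`.
Only this direction is needed, because all index quantifiers are universal; the contraction may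
depend on the assignment. -/
theorem Contraction.sat_of_sat {Q : Type u} {A : Type v} {P : ProcessTemplate Q A} {k : ℕ}
    {Φ : UnivFormula k} {G : Topology}
    (h : ∀ g : Fin k → Fin G.size, ∃ (H : Topology) (c : Fin G.size → Fin H.size),
      2 ≤ H.size ∧ Contraction G H g c ∧ Sat P H Φ) : Sat P G Φ := by
  intro g hg s hs
  obtain ⟨H, c, hH, hc, hsat⟩ := h g
  have key := hsat (fun r => c (g r)) fun i => by
    have := hg i
    cases hgu : Φ.guard i with
    | none => trivial
    | mem Y =>
      rw [hgu] at this
      obtain ⟨y, hy, e⟩ := this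
      exact ⟨y, hy, congrArg c e⟩
    | edge y =>
      -- If `c` identified the two ends of the edge, they would be equal, since selected vertices
      -- are alone in their fibers; but topologies have no self-loops.
      rw [hgu] at this
      refine hc.proj _ _ this fun e => ?_
      have e' := hc.fiber _ _ e
      have this : G.edge (g (Fin.castLE i.isLt.le y)) (g i) := this
      exact G.irrefl _ (e' ▸ this)
  let u : Fin H.size → Q := fun w => if w = H.init then P.initTok else P.initNon
  have hu : u ∈ (system P H).init :=
    mem_system_init.2 ⟨fun i hi => by simp [u, hi], fun i hi => by simp [u, hi]⟩
  refine (hc.satState_iff hH Φ.matrix id ⟨⟨G.init, H.init, fun j => (hs j).2, fun j => (hu j).2,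
    hc.init⟩, fun r => ?_⟩).2 (key u hu)
  obtain ⟨h1, h2⟩ := mem_system_init.1 hs
  by_cases hr : g r = G.init
  · simp [u, hr, hc.init, h1]
  · rw [h2 _ hr]
    have : c (g r) ≠ H.init := fun e => hr (hc.fiber r G.init (by rw [hc.init, e])).symm
    simp [u, this]

end TokenPassing

namespace TokenPassing

open Relation Function

/-! ## Contracting the members of the topology families -/

/-- Every member of `𝒢` with more than `N` vertices can be contracted by one vertex, whichever `k`
vertices are selected. -/
def ContractsAbove (𝒢 : Set Topology) (k N : ℕ) : Prop :=
  ∀ G ∈ 𝒢, N < G.size → ∀ g : Fin k → Fin G.size,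
    ∃ H ∈ 𝒢, H.size + 1 = G.size ∧ ∃ c : Fin G.size → Fin H.size, Contraction G H g c

/-- Induction on the size, removing one vertex at a time. As only topologies with more than `N ≥ 2`
vertices are contracted, the results have at least two vertices. -/
theorem ContractsAbove.sat_iff {𝒢 : Set Topology} {k N : ℕ} (h : ContractsAbove 𝒢 k N)
    (hN : 2 ≤ N) {Q : Type u} {A : Type v} (P : ProcessTemplate Q A) (Φ : UnivFormula k) :
    (∀ G ∈ 𝒢, G.size ≤ N → Sat P G Φ) ↔ ∀ G ∈ 𝒢, Sat P G Φ := by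
  refine ⟨fun hs => ?_, fun hs G hG _ => hs G hG⟩
  have : ∀ n, ∀ G ∈ 𝒢, G.size = n → Sat P G Φ := by
    intro n
    induction n using Nat.strong_induction_on with
    | _ n ih =>
      rintro G hG rfl
      by_cases hle : G.size ≤ N
      · exact hs G hG hle
      · refine Contraction.sat_of_sat fun g => ?_
        obtain ⟨H, hH, hsz, c, hc⟩ := h G hG (not_le.1 hle) g
        exact ⟨H, c, by omega, hc, ih H.size (by omega) H hH rfl⟩
  exact fun G hG => this _ G hG rfl

theorem ContractsAbove.isCutoff {𝒢 : Set Topology} {k N : ℕ} (h : ContractsAbove 𝒢 k N)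
    (hN : 2 ≤ N) : IsCutoff.{u, v} 𝒢 k N :=
  fun _ _ P Φ => h.sat_iff hN P Φ

/-- `c` identifies `x` with `y`, and nothing else. -/
def Identifies {V W : Type*} (c : V → W) (x y : V) : Prop :=
  ∀ v t, c v = c t ↔ v = t ∨ (v = x ∧ t = y) ∨ (v = y ∧ t = x)

theorem Identifies.fiber {V W I : Type*} {c : V → W} {x y : V} (h : Identifies c x y) {g : I → V}
    (hx : ∀ r, g r ≠ x) (hy : ∀ r, g r ≠ y) (r : I) (v : V) (e : c v = c (g r)) : v = g r := by
  rcases (h _ _).1 e with e | ⟨-, e⟩ | ⟨-, e⟩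
  · exact e
  · exact absurd e (hy r)
  · exact absurd e (hx r)

theorem Identifies.path {G : Topology} {W : Type*} {c : Fin G.size → W} {x y : Fin G.size}
    (h : Identifies c x y) (hxy : G.edge x y) (hyx : G.edge y x) {v t : Fin G.size}
    (e : c v = c t) : ReflTransGen (ClassEdge G c) v t := by
  rcases (h _ _).1 e with rfl | ⟨rfl, rfl⟩ | ⟨rfl, rfl⟩
  · exact .refl
  · exact .single ⟨hxy, e⟩
  · exact .single ⟨hyx, e⟩

theorem exists_identifies {n : ℕ} {x y : Fin (n + 1)} (hxy : x ≠ y) :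
    ∃ c : Fin (n + 1) → Fin n, Surjective c ∧ Identifies c x y := by
  -- The vertices other than `y` are renumbered, and `y` is sent to the image of `x`.
  have e : {v // v ≠ y} ≃ Fin n := Fintype.equivFinOfCardEq (by simp)
  refine ⟨fun v => if h : v = y then e ⟨x, hxy⟩ else e ⟨v, h⟩, fun b => ?_, fun v t => ?_⟩
  · refine ⟨(e.symm b).1, ?_⟩
    simp [(e.symm b).2]
  · by_cases hv : v = y <;> by_cases ht : t = y
    · simp [hv, ht]
    · simp only [hv, ht, dite_true, dite_false, e.apply_eq_iff_eq, Subtype.mk.injEq]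
      have := Ne.symm ht
      tauto
    · simp only [hv, ht, dite_true, dite_false, e.apply_eq_iff_eq, Subtype.mk.injEq]
      tauto
    · simp only [hv, ht, dite_false, e.apply_eq_iff_eq, Subtype.mk.injEq]
      tauto

theorem exists_two_unselected {k n : ℕ} (h : k + 1 ≤ n) (g : Fin k → Fin (n + 1)) :
    ∃ x y : Fin (n + 1), x ≠ y ∧ (∀ r, g r ≠ x) ∧ ∀ r, g r ≠ y := by
  classical
  have h1 : (Finset.univ.image g).card ≤ k := by
    simpa using Finset.card_image_le (s := Finset.univ) (f := g)
  have h2 : 1 < (Finset.univ.image g)ᶜ.card := by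
    rw [Finset.card_compl, Fintype.card_fin]; omega
  obtain ⟨x, hx, y, hy, hne⟩ := Finset.one_lt_card.1 h2
  refine ⟨x, y, hne, ?_, ?_⟩
  · simpa using hx
  · simpa using hy

/-- Any two unselected vertices can be merged, and no move inside the merged class is ever needed:
vertices of different classes are adjacent. -/
theorem contractsAbove_cliques {m k N : ℕ} (hm : m ≤ 2) (hN : 2 ≤ N) (hk : k + 1 ≤ N) :
    ContractsAbove (cliques m) k N := by
  rintro ⟨_ | n, edge, init, irr⟩ ⟨hmG, hG⟩ hlt g
  · exact init.elim0
  simp only at hlt hmG hG g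
  obtain ⟨x, y, hxy, hx, hy⟩ := exists_two_unselected (by omega) g
  obtain ⟨c, hsurj, hc⟩ := exists_identifies hxy
  refine ⟨⟨n, fun i j => i ≠ j, c init, by simp⟩, ⟨by simp only; omega, by simp⟩, rfl, c, rfl,
    hc.fiber hx hy, hsurj, fun v w _ e => e, fun v t e => ⟨v, t, .refl, ?_, .refl⟩⟩
  exact (hG v t).2 fun h => e (congrArg c h)

/-- Any two unselected vertices can be merged, the center included. Two merged leaves are not
adjacent, but they need no path between them: every move between classes starts or ends in the class
of the center, and inside that class each vertex is joined to the center in both directions. -/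
theorem contractsAbove_stars {m k N : ℕ} (hm : m ≤ 2) (hN : 2 ≤ N) (hk : k + 1 ≤ N) :
    ContractsAbove (stars m) k N := by
  rintro ⟨_ | n, edge, init, irr⟩ ⟨hmG, h, hG⟩ hlt g
  · exact init.elim0
  simp only at hlt hmG h hG g
  obtain ⟨x, y, hxy, hx, hy⟩ := exists_two_unselected (by omega) g
  obtain ⟨c, hsurj, hc⟩ := exists_identifies hxy
  let G : Topology := ⟨n + 1, edge, init, irr⟩
  have hto : ∀ v, c v = c h → ReflTransGen (ClassEdge G c) v h := fun v e => by
    by_cases hv : v = h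
    · rw [hv]
    · exact .single ⟨(hG v h).2 ⟨hv, .inr rfl⟩, e⟩
  have hfrom : ∀ v, c v = c h → ReflTransGen (ClassEdge G c) h v := fun v e => by
    by_cases hv : v = h
    · rw [hv]
    · exact .single ⟨(hG h v).2 ⟨Ne.symm hv, .inl rfl⟩, e.symm⟩
  refine ⟨⟨n, fun i j => i ≠ j ∧ (i = c h ∨ j = c h), c init, by simp⟩,
    ⟨by simp only; omega, c h, by simp⟩, rfl, c, rfl, hc.fiber hx hy, hsurj,
    fun v w e hne => ⟨hne, ((hG v w).1 e).2.imp (congrArg c) (congrArg c)⟩, ?_⟩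
  rintro v t ⟨hne, e | e⟩
  · have ht : h ≠ t := fun e' => hne (e' ▸ e)
    exact ⟨h, t, hto v e, (hG h t).2 ⟨ht, .inl rfl⟩, .refl⟩
  · have hv : v ≠ h := fun e' => hne (e' ▸ e.symm)
    exact ⟨v, h, .refl, (hG v h).2 ⟨hv, .inr rfl⟩, hfrom t e⟩

theorem val_eq_succ_mod {n : ℕ} (i j : Fin (n + 1)) : (j : ℕ) = (i + 1) % (n + 1) ↔ j = i + 1 := by
  rw [Fin.ext_iff, Fin.val_add, Fin.val_one', Nat.add_mod_mod]

theorem succ_mod_of_lt {i n : ℕ} (h : i < n) : (i + 1) % n = if i + 1 = n then 0 else i + 1 := by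
  split_ifs with e
  · rw [e, Nat.mod_self]
  · exact Nat.mod_eq_of_lt (by omega)

/-- In a ring, two adjacent vertices can be identified. -/
theorem exists_identifies_succ {n : ℕ} (hn : 2 ≤ n) (x : Fin (n + 1)) :
    ∃ c : Fin (n + 1) → Fin n, Surjective c ∧ Identifies c x (x + 1) ∧
      ∀ v ≠ x, (c (v + 1) : ℕ) = (c v + 1) % n := by
  have hs : ∀ v : Fin (n + 1), ((v + 1 : Fin (n + 1)) : ℕ) =
      if (v : ℕ) = n then (0 : ℕ) else (v : ℕ) + 1 := by
    intro v
    have := (val_eq_succ_mod v (v + 1)).2 rfl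
    rw [this, succ_mod_of_lt v.2]
    simp
  have hx := x.2
  -- If `x` is the last vertex, its successor is `0`, so the last vertex is sent to `0`. Otherwise
  -- the vertices after `x` are shifted down by one.
  refine ⟨fun j => ⟨if (x : ℕ) = n then (if (j : ℕ) = n then (0 : ℕ) else (j : ℕ))
    else if (j : ℕ) ≤ x then (j : ℕ) else (j : ℕ) - 1, by have := j.2; split_ifs <;> omega⟩,
    fun b => ?_, fun v t => ?_, fun v hv => ?_⟩
  · refine ⟨⟨if (b : ℕ) ≤ x then (b : ℕ) else (b : ℕ) + 1, by have := b.2; split_ifs <;> omega⟩, ?_⟩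
    have := b.2
    ext
    simp only
    split_ifs <;> omega
  · have := v.2
    have := t.2
    simp only [Fin.ext_iff, hs]
    split_ifs <;> omega
  · have := v.2
    rw [succ_mod_of_lt (Fin.is_lt _)]
    have hv' : (v : ℕ) ≠ x := fun e => hv (Fin.ext e)
    simp only [hs]
    split_ifs <;> omega

/-- The source of the cutoff `2 * k`: if of any two neighbors one were selected, the selected
vertices and their predecessors, at most `2 * k` in number, would cover the ring. -/
theorem exists_adjacent_unselected {k n : ℕ} (h : 2 * k ≤ n) (g : Fin k → Fin (n + 1)) :
    ∃ x : Fin (n + 1), (∀ r, g r ≠ x) ∧ ∀ r, g r ≠ x + 1 := by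
  classical
  by_contra! hc
  have hsub : (Finset.univ : Finset (Fin (n + 1))) ⊆
      Finset.univ.image g ∪ Finset.univ.image fun r => g r - 1 := by
    intro x _
    simp only [Finset.mem_union, Finset.mem_image, Finset.mem_univ, true_and]
    by_cases hx : ∃ r, g r = x
    · exact .inl hx
    · obtain ⟨r, hr⟩ := hc x fun r e => hx ⟨r, e⟩
      exact .inr ⟨r, by rw [hr, add_sub_cancel_right]⟩
  have h1 := (Finset.card_le_card hsub).trans (Finset.card_union_le _ _)
  have h2 : (Finset.univ.image g).card ≤ k := by
    simpa using Finset.card_image_le (s := Finset.univ) (f := g)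
  have h3 : (Finset.univ.image fun r => g r - 1).card ≤ k := by
    simpa using Finset.card_image_le (s := Finset.univ) (f := fun r => g r - 1)
  simp only [Finset.card_univ, Fintype.card_fin] at h1
  omega

/-- An edge between classes of a ring comes from an edge of the ring. -/
theorem exists_succ_rep {n : ℕ} {x : Fin (n + 1)} {c : Fin (n + 1) → Fin n} (hn : 2 ≤ n)
    (hc : Identifies c x (x + 1)) (hs : ∀ v ≠ x, (c (v + 1) : ℕ) = (c v + 1) % n)
    {v t : Fin (n + 1)} (h : (c t : ℕ) = (c v + 1) % n) :
    ∃ w, w ≠ x ∧ (w = v ∨ v = x ∧ w = x + 1) ∧ c w = c v ∧ c (w + 1) = c t := by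
  have hne : x + 1 ≠ x := by
    have : NeZero n := ⟨by omega⟩
    simp
  -- The edge out of `x` stays inside the merged pair, so `x` must be replaced by `x + 1`, from
  -- which the ring leaves the pair.
  by_cases hv : v = x
  · have e : c (x + 1) = c v := by rw [hv]; exact (hc _ _).2 (.inr (.inr ⟨rfl, rfl⟩))
    exact ⟨x + 1, hne, .inr ⟨hv, rfl⟩, e, Fin.ext (by rw [hs _ hne, e, h])⟩
  · exact ⟨v, hv, .inl rfl, rfl, Fin.ext (by rw [hs _ hv, h])⟩

theorem succ_mod_ne {i n : ℕ} (hn : 2 ≤ n) (h : i < n) : i ≠ (i + 1) % n := by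
  rw [succ_mod_of_lt h]; split_ifs <;> omega

/-- Inside the merged pair the token can go only from `x` to `x + 1`. This suffices, since it enters
the pair at `x` and leaves it from `x + 1`, so it can be held at either vertex on the way. -/
theorem contractsAbove_uniRings {k N : ℕ} (hN : 2 ≤ N) (hk : 2 * k ≤ N) :
    ContractsAbove uniRings k N := by
  rintro ⟨_ | n, edge, init, irr⟩ hG hlt g
  · exact init.elim0
  replace hG : ∀ i j, edge i j ↔ j = i + 1 := fun i j => (hG i j).trans (val_eq_succ_mod i j)
  simp only at hlt g
  have hn : 2 ≤ n := by omega
  obtain ⟨x, hx, hy⟩ := exists_adjacent_unselected (by omega) g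
  obtain ⟨c, hsurj, hc, hs⟩ := exists_identifies_succ hn x
  refine ⟨⟨n, fun i j => (j : ℕ) = (i + 1) % n, c init, fun i => succ_mod_ne hn i.2⟩,
    fun i j => Iff.rfl, rfl, c, rfl, hc.fiber hx hy, hsurj, fun v w e hne => ?_, fun v t e => ?_⟩
  · obtain rfl := (hG _ _).1 e
    exact hs v fun e => hne ((hc _ _).2 (.inr (.inl ⟨e, by rw [e]⟩)))
  · obtain ⟨w, hw, hwv, h1, h2⟩ := exists_succ_rep hn hc hs e
    refine ⟨w, w + 1, ?_, (hG _ _).2 rfl, ?_⟩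
    · rcases hwv with rfl | ⟨rfl, rfl⟩
      · exact .refl
      · exact .single ⟨(hG _ _).2 rfl, h1.symm⟩
    · rcases (hc _ _).1 h2 with e | ⟨e, e'⟩ | ⟨e, -⟩
      · rw [e]
      · exact .single ⟨(hG _ _).2 (by rw [e, e']), h2⟩
      -- An entry at `x + 1` would come from `x`, which lies in the same class.
      · exact absurd (add_right_cancel e) hw

theorem contractsAbove_biRings {k N : ℕ} (hN : 2 ≤ N) (hk : 2 * k ≤ N) :
    ContractsAbove biRings k N := by
  rintro ⟨_ | n, edge, init, irr⟩ hG hlt g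
  · exact init.elim0
  replace hG : ∀ i j, edge i j ↔ (j = i + 1 ∨ i = j + 1) := fun i j =>
    (hG i j).trans (or_congr (val_eq_succ_mod i j) (val_eq_succ_mod j i))
  simp only at hlt g
  have hn : 2 ≤ n := by omega
  obtain ⟨x, hx, hy⟩ := exists_adjacent_unselected (by omega) g
  obtain ⟨c, hsurj, hc, hs⟩ := exists_identifies_succ hn x
  let G : Topology := ⟨n + 1, edge, init, irr⟩
  have hpath : ∀ v t, c v = c t → ReflTransGen (ClassEdge G c) v t := fun v t =>
    hc.path (G := G) ((hG _ _).2 (.inl rfl)) ((hG _ _).2 (.inr rfl))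
  refine ⟨⟨n, fun i j => (j : ℕ) = (i + 1) % n ∨ (i : ℕ) = (j + 1) % n, c init, fun i h =>
    succ_mod_ne hn i.2 (or_self_iff.1 h)⟩,
    fun i j => Iff.rfl, rfl, c, rfl, hc.fiber hx hy, hsurj, fun v w e hne => ?_, fun v t e => ?_⟩
  · rcases (hG _ _).1 e with rfl | rfl
    · exact .inl (hs v fun e => hne ((hc _ _).2 (.inr (.inl ⟨e, by rw [e]⟩))))
    · exact .inr (hs w fun e => hne ((hc _ _).2 (.inr (.inr ⟨by rw [e], e⟩))))
  · rcases e with e | e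
    · obtain ⟨w, -, -, h1, h2⟩ := exists_succ_rep hn hc hs e
      exact ⟨w, w + 1, hpath _ _ h1.symm, (hG _ _).2 (.inl rfl), hpath _ _ h2⟩
    · obtain ⟨w, -, -, h1, h2⟩ := exists_succ_rep hn hc hs e
      exact ⟨w + 1, w, hpath _ _ h2.symm, (hG _ _).2 (.inr rfl), hpath _ _ h1⟩

end TokenPassing

namespace TokenPassing

open Relation

/-! ## Gödel numbers of formulas -/

section Code

variable {k : ℕ}

mutual
theorem StateFormula.code_inj : ∀ φ χ : StateFormula (ℕ × Fin k), φ.code = χ.code → φ = χ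
  | .tt, χ, h => by cases χ <;> simp [StateFormula.code] at h ⊢
  | .atom x, χ, h => by
    cases χ <;> simp [StateFormula.code] at h ⊢
    exact Prod.ext h.1 (Fin.ext h.2)
  | .neg φ, χ, h => by
    cases χ <;> simp [StateFormula.code] at h ⊢
    exact StateFormula.code_inj _ _ h
  | .and φ φ', χ, h => by
    cases χ <;> simp [StateFormula.code] at h ⊢
    exact ⟨StateFormula.code_inj _ _ h.1, StateFormula.code_inj _ _ h.2⟩
  | .ex ψ, χ, h => by
    cases χ <;> simp [StateFormula.code] at h ⊢
    exact PathFormula.code_inj _ _ h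
theorem PathFormula.code_inj : ∀ φ χ : PathFormula (ℕ × Fin k), φ.code = χ.code → φ = χ
  | .state φ, χ, h => by
    cases χ <;> simp [PathFormula.code] at h ⊢
    exact StateFormula.code_inj _ _ h
  | .neg φ, χ, h => by
    cases χ <;> simp [PathFormula.code] at h ⊢
    exact PathFormula.code_inj _ _ h
  | .and φ φ', χ, h => by
    cases χ <;> simp [PathFormula.code] at h ⊢
    exact ⟨PathFormula.code_inj _ _ h.1, PathFormula.code_inj _ _ h.2⟩
  | .untl φ φ', χ, h => by
    cases χ <;> simp [PathFormula.code] at h ⊢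
    exact ⟨PathFormula.code_inj _ _ h.1, PathFormula.code_inj _ _ h.2⟩
end

theorem lt_pair_right {a : ℕ} (ha : 1 ≤ a) (b : ℕ) : b < Nat.pair a b :=
  lt_of_lt_of_le (by omega) (Nat.add_le_pair a b)

theorem lt_pair_pair_left {a : ℕ} (ha : 1 ≤ a) (b c : ℕ) : b < Nat.pair a (Nat.pair b c) :=
  (Nat.left_le_pair b c).trans_lt (lt_pair_right ha _)

theorem lt_pair_pair_right {a : ℕ} (ha : 1 ≤ a) (b c : ℕ) : c < Nat.pair a (Nat.pair b c) :=
  (Nat.right_le_pair b c).trans_lt (lt_pair_right ha _)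

/-- The tag of the Gödel number of a formula. -/
def tag (x : ℕ) : ℕ := x.unpair.1

/-- The component of the Gödel number of a formula. -/
def arg (x : ℕ) : ℕ := x.unpair.2

/-- The first of two components of the Gödel number of a formula. -/
def argL (x : ℕ) : ℕ := x.unpair.2.unpair.1

/-- The second of two components of the Gödel number of a formula. -/
def argR (x : ℕ) : ℕ := x.unpair.2.unpair.2

@[simp] theorem tag_pair (a b : ℕ) : tag (Nat.pair a b) = a := by simp [tag]
@[simp] theorem arg_pair (a b : ℕ) : arg (Nat.pair a b) = b := by simp [arg]
@[simp] theorem argL_pair (a b c : ℕ) : argL (Nat.pair a (Nat.pair b c)) = b := by simp [argL]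
@[simp] theorem argR_pair (a b c : ℕ) : argR (Nat.pair a (Nat.pair b c)) = c := by simp [argR]

/-- Membership in the finite set of natural numbers that is given by a bit mask. -/
def Bit (Z x : ℕ) : Prop := Z.testBit x = true

theorem Bit.lt {Z x N : ℕ} (h : Bit Z x) (hZ : Z < 2 ^ N) : x < N := by
  by_contra hc
  have := Nat.testBit_lt_two_pow (hZ.trans_le (Nat.pow_le_pow_right two_pos (not_lt.1 hc)))
  rw [Bit, this] at h
  exact absurd h (by simp)

/-- Quantification over subsets of an initial segment becomes bounded quantification over numbers,
which keeps the predicates primitive recursive. -/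
theorem exists_bits (N : ℕ) (S : ℕ → Prop) : ∃ Z < 2 ^ N, ∀ x, Bit Z x ↔ x < N ∧ S x := by
  classical
  refine ⟨Nat.ofBits fun i : Fin N => decide (S i), Nat.ofBits_lt_two_pow _, fun x => ?_⟩
  by_cases hx : x < N
  · simp [Bit, Nat.testBit_ofBits_lt _ _ hx, hx]
  · simp [Bit, Nat.testBit_ofBits_ge _ _ (not_lt.1 hx), hx]

end Code

/-! ## Numerical model checking -/

/-- A finite transition system on numbers below `size`, with `fairCount` many fairness conditions;
`label p i s` says that the atom `p` of the variable `i` holds in `s`. -/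
structure NumSystem where
  size : ℕ
  fairCount : ℕ
  step : ℕ → ℕ → Prop
  label : ℕ → ℕ → ℕ → Prop
  fair : ℕ → ℕ → Prop

namespace NumSystem

/-- `x` has the form of a Gödel number of a formula with `k` variables, and the Gödel numbers of its
components are in `W`. -/
def Typed (k W x : ℕ) : Prop :=
  tag x < 9 ∧ (tag x = 0 → arg x = 0) ∧ (tag x = 1 → argR x < k) ∧
    ((tag x = 2 ∨ tag x = 5) → Bit W (arg x) ∧ tag (arg x) < 5) ∧
    ((tag x = 4 ∨ tag x = 6) → Bit W (arg x) ∧ ¬ tag (arg x) < 5) ∧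
    (tag x = 3 → (Bit W (argL x) ∧ tag (argL x) < 5) ∧ Bit W (argR x) ∧ tag (argR x) < 5) ∧
    ((tag x = 7 ∨ tag x = 8) →
      (Bit W (argL x) ∧ ¬ tag (argL x) < 5) ∧ Bit W (argR x) ∧ ¬ tag (argR x) < 5)

/-- The set of path formulas in the tableau node `z` is consistent, given the table `T` of true
state formulas. A node is a pair of a state and a set of path formulas. -/
def Consistent (r W T z : ℕ) : Prop :=
  ∀ x < r + 1, Bit W x →
    (tag x = 5 → (Bit z.unpair.2 x ↔ Bit T (Nat.pair (arg x) z.unpair.1))) ∧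
    (tag x = 6 → (Bit z.unpair.2 x ↔ ¬ Bit z.unpair.2 (arg x))) ∧
    (tag x = 7 → (Bit z.unpair.2 x ↔ Bit z.unpair.2 (argL x) ∧ Bit z.unpair.2 (argR x)))

variable (K : NumSystem)

/-- The edges of the tableau. -/
def Edge (r W z z' : ℕ) : Prop :=
  K.step z.unpair.1 z'.unpair.1 ∧ ∀ x < r + 1, Bit W x → tag x = 8 →
    (Bit z.unpair.2 x ↔
      Bit z.unpair.2 (argR x) ∨ (Bit z.unpair.2 (argL x) ∧ Bit z'.unpair.2 x))

/-- A bound for the nodes of the tableau. -/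
def nodes (r : ℕ) : ℕ := (K.size + 2 ^ (r + 1) + 1) * (K.size + 2 ^ (r + 1) + 1)

/-- A nonempty path in the set `Z` of nodes leads from `z` to a node that satisfies `C`. -/
def Reach (r W Z z : ℕ) (C : ℕ → Prop) : Prop :=
  ∀ Y < 2 ^ K.nodes r, (∀ y < K.nodes r, Bit Z y → K.Edge r W z y → Bit Y y) →
    (∀ y < K.nodes r, Bit Y y → ∀ y' < K.nodes r, Bit Z y' → K.Edge r W y y' → Bit Y y') →
    ∃ y < K.nodes r, Bit Y y ∧ Bit Z y ∧ C y

/-- The path formula `r` holds along some fair path from `s`, as witnessed by a set of tableau nodes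
each of which can reach each acceptance condition within the set. -/
def Win (r W T s : ℕ) : Prop :=
  ∃ Z < 2 ^ K.nodes r,
    (∀ z < K.nodes r, Bit Z z → z.unpair.1 < K.size ∧ Consistent r W T z ∧
      (∀ i < K.fairCount, K.Reach r W Z z fun y => K.fair i y.unpair.1) ∧
      ∀ x < r + 1, Bit W x → tag x = 8 →
        K.Reach r W Z z fun y => ¬ Bit y.unpair.2 x ∨ Bit y.unpair.2 (argR x)) ∧
    ∃ z < K.nodes r, Bit Z z ∧ z.unpair.1 = s ∧ Bit z.unpair.2 r

/-- The table `T` of true state formulas is correct at `x`. -/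
def Correct (W T x : ℕ) : Prop :=
  ∀ s < K.size,
    (tag x = 0 → Bit T (Nat.pair x s)) ∧
    (tag x = 1 → (Bit T (Nat.pair x s) ↔ K.label (argL x) (argR x) s)) ∧
    (tag x = 2 → (Bit T (Nat.pair x s) ↔ ¬ Bit T (Nat.pair (arg x) s))) ∧
    (tag x = 3 → (Bit T (Nat.pair x s) ↔
      Bit T (Nat.pair (argL x) s) ∧ Bit T (Nat.pair (argR x) s))) ∧
    (tag x = 4 → (Bit T (Nat.pair x s) ↔ K.Win (arg x) W T s))

/-- The state formula with Gödel number `m` and `k` variables holds in `s`. -/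
def Check (k m s : ℕ) : Prop :=
  ∃ W < 2 ^ (m + 1), ∃ T < 2 ^ ((m + K.size + 1) * (m + K.size + 1)),
    Bit W m ∧ (∀ x < m + 1, Bit W x → Typed k W x ∧ K.Correct W T x) ∧ Bit T (Nat.pair m s)

end NumSystem

/-- Local well-formedness suffices because components have smaller Gödel numbers, so decoding is by
strong induction. Tags below `5` belong to state formulas, those from `5` to `8` to path formulas.
-/
theorem Typed.exists_formula {k W m : ℕ}
    (h : ∀ x < m, Bit W x → NumSystem.Typed k W x) :
    ∀ x < m, Bit W x → (tag x < 5 → ∃ φ : StateFormula (ℕ × Fin k), φ.code = x) ∧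
      (¬ tag x < 5 → ∃ ψ : PathFormula (ℕ × Fin k), ψ.code = x) := by
  intro x
  induction x using Nat.strong_induction_on with
  | _ x ih =>
    intro hxm hx
    obtain ⟨h9, h0, h1, h25, h46, h3, h78⟩ := h x hxm hx
    rw [← Nat.pair_unpair x] at *
    generalize x.unpair.1 = a at *
    generalize x.unpair.2 = b at *
    simp only [tag_pair, arg_pair] at *
    have sub : 1 ≤ a → Bit W b → (tag b < 5 → ∃ φ : StateFormula (ℕ × Fin k), φ.code = b) ∧
        (¬ tag b < 5 → ∃ ψ : PathFormula (ℕ × Fin k), ψ.code = b) := fun ha =>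
      ih b (lt_pair_right ha b) ((lt_pair_right ha b).trans hxm)
    have subL : 1 ≤ a → Bit W b.unpair.1 →
        (tag b.unpair.1 < 5 → ∃ φ : StateFormula (ℕ × Fin k), φ.code = b.unpair.1) ∧
        (¬ tag b.unpair.1 < 5 → ∃ ψ : PathFormula (ℕ × Fin k), ψ.code = b.unpair.1) := fun ha =>
      have hlt := (Nat.unpair_left_le b).trans_lt (lt_pair_right ha b)
      ih _ hlt (hlt.trans hxm)
    have subR : 1 ≤ a → Bit W b.unpair.2 →
        (tag b.unpair.2 < 5 → ∃ φ : StateFormula (ℕ × Fin k), φ.code = b.unpair.2) ∧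
        (¬ tag b.unpair.2 < 5 → ∃ ψ : PathFormula (ℕ × Fin k), ψ.code = b.unpair.2) := fun ha =>
      have hlt := (Nat.unpair_right_le b).trans_lt (lt_pair_right ha b)
      ih _ hlt (hlt.trans hxm)
    simp only [argL, argR, Nat.unpair_pair] at h1 h3 h78
    interval_cases a
    · exact ⟨fun _ => ⟨.tt, by rw [h0 rfl]; rfl⟩, fun hc => absurd (by norm_num) hc⟩
    · refine ⟨fun _ => ⟨.atom (b.unpair.1, ⟨b.unpair.2, h1 rfl⟩), ?_⟩,
        fun hc => absurd (by norm_num) hc⟩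
      simp [StateFormula.code]
    · obtain ⟨φ, hφ⟩ := (sub le_add_self (h25 (.inl rfl)).1).1 (h25 (.inl rfl)).2
      exact ⟨fun _ => ⟨.neg φ, by rw [← hφ]; rfl⟩, fun hc => absurd (by norm_num) hc⟩
    · obtain ⟨⟨h4, h5⟩, h6, h7⟩ := h3 rfl
      obtain ⟨φ, hφ⟩ := (subL le_add_self h4).1 h5
      obtain ⟨χ, hχ⟩ := (subR le_add_self h6).1 h7
      exact ⟨fun _ => ⟨.and φ χ, by simp [StateFormula.code, hφ, hχ]⟩,
        fun hc => absurd (by norm_num) hc⟩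
    · obtain ⟨φ, hφ⟩ := (sub le_add_self (h46 (.inl rfl)).1).2 (h46 (.inl rfl)).2
      exact ⟨fun _ => ⟨.ex φ, by rw [← hφ]; rfl⟩, fun hc => absurd (by norm_num) hc⟩
    · obtain ⟨φ, hφ⟩ := (sub le_add_self (h25 (.inr rfl)).1).1 (h25 (.inr rfl)).2
      exact ⟨fun hc => absurd hc (by norm_num), fun _ => ⟨.state φ, by rw [← hφ]; rfl⟩⟩
    · obtain ⟨φ, hφ⟩ := (sub le_add_self (h46 (.inr rfl)).1).2 (h46 (.inr rfl)).2
      exact ⟨fun hc => absurd hc (by norm_num), fun _ => ⟨.neg φ, by rw [← hφ]; rfl⟩⟩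
    · obtain ⟨⟨h4, h5⟩, h6, h7⟩ := h78 (.inl rfl)
      obtain ⟨φ, hφ⟩ := (subL le_add_self h4).2 h5
      obtain ⟨χ, hχ⟩ := (subR le_add_self h6).2 h7
      exact ⟨fun hc => absurd hc (by norm_num),
        fun _ => ⟨.and φ χ, by simp [PathFormula.code, hφ, hχ]⟩⟩
    · obtain ⟨⟨h4, h5⟩, h6, h7⟩ := h78 (.inr rfl)
      obtain ⟨φ, hφ⟩ := (subL le_add_self h4).2 h5
      obtain ⟨χ, hχ⟩ := (subR le_add_self h6).2 h7
      exact ⟨fun hc => absurd hc (by norm_num),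
        fun _ => ⟨.untl φ χ, by simp [PathFormula.code, hφ, hχ]⟩⟩

/-! ## Until as a fixed point -/

/-- `b` holds at some position from `n` on, and `a` at all positions before it. -/
def Until (a b : ℕ → Prop) (n : ℕ) : Prop := ∃ j, b (n + j) ∧ ∀ i < j, a (n + i)

theorem until_iff {a b : ℕ → Prop} {n : ℕ} :
    Until a b n ↔ b n ∨ (a n ∧ Until a b (n + 1)) := by
  constructor
  · rintro ⟨_ | j, hj, hi⟩
    · exact .inl hj
    · refine .inr ⟨hi 0 (by omega), j, by rwa [show n + 1 + j = n + (j + 1) by omega],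
        fun i h => ?_⟩
      rw [show n + 1 + i = n + (i + 1) by omega]
      exact hi _ (by omega)
  · rintro (h | ⟨ha, j, hj, hi⟩)
    · exact ⟨0, h, fun i hi => absurd hi (by omega)⟩
    · refine ⟨j + 1, by rwa [show n + (j + 1) = n + 1 + j by omega], fun i h => ?_⟩
      rcases i with _ | i
      · exact ha
      · rw [show n + (i + 1) = n + 1 + i by omega]
        exact hi i (by omega)

/-- The unfolding equation alone also admits solutions that promise `b` forever without fulfilling
it. The hypothesis `hf`, the acceptance condition of the tableau, excludes them. -/
theorem eq_until_of_fixpoint {a b u : ℕ → Prop} (h : ∀ n, u n ↔ b n ∨ (a n ∧ u (n + 1)))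
    (hf : ∀ n, ∃ m ≥ n, ¬ u m ∨ b m) (n : ℕ) : u n ↔ Until a b n := by
  constructor
  · intro hu
    by_contra hc
    have : ∀ i, u (n + i) ∧ ¬ Until a b (n + i) := by
      intro i
      induction i with
      | zero => exact ⟨hu, hc⟩
      | succ i ih =>
        obtain ⟨h1, h2⟩ := ih
        rw [until_iff] at h2
        have := (h _).1 h1
        rw [← Nat.add_assoc]
        tauto
    obtain ⟨m, hm, hb⟩ := hf n
    have h1 := this (m - n)
    rw [Nat.add_sub_cancel' hm, until_iff] at h1
    tauto
  · rintro ⟨j, hj, hi⟩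
    induction j generalizing n with
    | zero => exact (h n).2 (.inl hj)
    | succ j ih =>
      refine (h n).2 (.inr ⟨hi 0 (by omega), ih (n + 1) ?_ fun i h => ?_⟩)
      · rwa [show n + 1 + j = n + (j + 1) by omega]
      · rw [show n + 1 + i = n + (i + 1) by omega]
        exact hi _ (by omega)

theorem satPath_untl_iff {AP S A : Type*} (M : LTS AP S A) (F : Set (ℕ → S))
    (ψ χ : PathFormula AP) (π : ℕ → S) (n : ℕ) :
    M.SatPath F (.untl ψ χ) (fun i => π (n + i)) ↔
      Until (fun n => M.SatPath F ψ fun i => π (n + i))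
        (fun n => M.SatPath F χ fun i => π (n + i)) n := by
  simp only [LTS.SatPath, Until, Nat.add_assoc]

/-! ## Correctness of numerical model checking -/

/-- `K` describes the transition system `M` with its fair paths, where `enc` numbers the states. -/
structure Represents (K : NumSystem) {AP S A : Type*} (M : LTS AP S A) (F : Set (ℕ → S)) {k : ℕ}
    (f : ℕ × Fin k → AP) (enc : S → ℕ) : Prop where
  inj : Function.Injective enc
  lt : ∀ s, enc s < K.size
  surj : ∀ j < K.size, ∃ s, enc s = j
  fairCount_pos : 0 < K.fairCount
  step : ∀ s s', K.step (enc s) (enc s') ↔ ∃ a, M.trans s a s'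
  label : ∀ p (i : Fin k) s, K.label p i (enc s) ↔ f (p, i) ∈ M.label s
  fair : ∀ π, π ∈ F ↔ ∀ i < K.fairCount, ∃ᶠ t in Filter.atTop, K.fair i (enc (π t))

namespace Represents

open NumSystem

variable {K : NumSystem} {AP S A : Type*} {M : LTS AP S A} {F : Set (ℕ → S)} {k : ℕ}
  {f : ℕ × Fin k → AP} {enc : S → ℕ}

/-- `Reach` quantifies over all sets closed under the edges inside `Z`; it is applied to the
smallest such set containing the successors of `z` in `Z`. -/
theorem reach_transGen {r W Z z : ℕ} {C : ℕ → Prop}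
    (h : K.Reach r W Z z C) :
    ∃ y, TransGen (fun y y' => Bit Z y' ∧ K.Edge r W y y') z y ∧ C y := by
  obtain ⟨Y, hY, hYm⟩ := exists_bits (K.nodes r)
    (TransGen (fun y y' => Bit Z y' ∧ K.Edge r W y y') z)
  obtain ⟨y, -, hy, -, hC⟩ := h Y hY
    (fun y hy hZy hE => (hYm y).2 ⟨hy, .single ⟨hZy, hE⟩⟩)
    (fun y _ hy' y' hy'' hZ hE => (hYm y').2 ⟨hy'', ((hYm y).1 hy').2.tail ⟨hZ, hE⟩⟩)
  exact ⟨y, ((hYm y).1 hy).2, hC⟩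

theorem reach_of_seq {r W Z : ℕ} {C : ℕ → Prop} {z : ℕ → ℕ} (hZ : Z < 2 ^ K.nodes r)
    (hz : ∀ i, Bit Z (z i)) (hE : ∀ i, K.Edge r W (z i) (z (i + 1))) {i j : ℕ} (hij : i < j)
    (hC : C (z j)) : K.Reach r W Z (z i) C := by
  intro Y hY h1 h2
  have : ∀ l, Bit Y (z (i + 1 + l)) := by
    intro l
    induction l with
    | zero => exact h1 _ ((hz _).lt hZ) (hz _) (hE i)
    | succ l ih => exact h2 _ ((hz _).lt hZ) ih _ ((hz _).lt hZ) (hz _) (hE _)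
  have hj := this (j - (i + 1))
  rw [Nat.add_sub_cancel' hij] at hj
  exact ⟨z j, (hz j).lt hZ, hj, hz j, hC⟩

/-- The witness is the set of nodes met by the given path, each position being paired with the set
of path formulas that are true from there on. All obligations of the tableau are fulfilled later on
this very path. -/
theorem win_of_path (H : Represents K M F f enc) {W T : ℕ} {ψ : PathFormula (ℕ × Fin k)}
    (hty : ∀ x < ψ.code + 1, Bit W x → Typed k W x)
    (hT : ∀ φ : StateFormula (ℕ × Fin k), φ.code < ψ.code → Bit W φ.code →
      ∀ s, Bit T (Nat.pair φ.code (enc s)) ↔ M.SatState F (φ.map f) s)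
    {π : ℕ → S} (hp : M.IsPath π) (hf : π ∈ F) (hs : M.SatPath F (ψ.map f) π) :
    K.Win ψ.code W T (enc (π 0)) := by
  set r := ψ.code with hr
  choose B hB hBm using fun i => exists_bits (r + 1) fun x =>
    ∃ χ : PathFormula (ℕ × Fin k), χ.code = x ∧ M.SatPath F (χ.map f) fun n => π (i + n)
  have hBc : ∀ i (χ : PathFormula (ℕ × Fin k)), χ.code < r + 1 →
      (Bit (B i) χ.code ↔ M.SatPath F (χ.map f) fun n => π (i + n)) := by
    intro i χ hχ
    rw [hBm]
    constructor
    · rintro ⟨-, χ', he, h⟩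
      rwa [← PathFormula.code_inj _ _ he]
    · exact fun h => ⟨hχ, χ, rfl, h⟩
  let z : ℕ → ℕ := fun i => Nat.pair (enc (π i)) (B i)
  have hz1 : ∀ i, (z i).unpair.1 = enc (π i) := fun i => by simp [z]
  have hz2 : ∀ i, (z i).unpair.2 = B i := fun i => by simp [z]
  have hzlt : ∀ i, z i < K.nodes r := fun i => by
    refine (Nat.pair_lt_max_add_one_sq _ _).trans_le ?_
    have h1 := H.lt (π i)
    have h2 := hB i
    rw [sq, nodes]
    apply Nat.mul_self_le_mul_self
    omega
  obtain ⟨Z, hZ, hZm⟩ := exists_bits (K.nodes r) fun y => ∃ i, y = z i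
  have hzZ : ∀ i, Bit Z (z i) := fun i => (hZm _).2 ⟨hzlt i, i, rfl⟩
  have hdec : ∀ x < r + 1, Bit W x → 5 ≤ tag x → ∃ χ : PathFormula (ℕ × Fin k), χ.code = x :=
    fun x hx hW h5 => (Typed.exists_formula hty x hx hW).2 (by omega)
  have hE : ∀ i, K.Edge r W (z i) (z (i + 1)) := by
    intro i
    refine ⟨by rw [hz1, hz1, H.step]; exact hp i, fun x hx hW h8 => ?_⟩
    obtain ⟨χ, rfl⟩ := hdec x hx hW (by omega)
    cases χ with
    | untl a b =>
      have ha := lt_pair_pair_left (a := 8) (by norm_num) a.code b.code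
      have hb := lt_pair_pair_right (a := 8) (by norm_num) a.code b.code
      rw [hz2, hz2, hBc _ _ hx, hBc _ _ hx]
      simp only [PathFormula.code, argL_pair, argR_pair] at hx ⊢
      rw [hBc _ _ (by omega), hBc _ _ (by omega)]
      simp only [PathFormula.map]
      rw [satPath_untl_iff, satPath_untl_iff]
      exact until_iff
    | _ => simp [PathFormula.code] at h8
  refine ⟨Z, hZ, ?_, z 0, hzlt 0, hzZ 0, hz1 0, ?_⟩
  · intro y _ hy
    obtain ⟨-, i, rfl⟩ := (hZm y).1 hy
    refine ⟨by rw [hz1]; exact H.lt _, fun x hx hW => ?_, fun c hc => ?_, fun x hx hW h8 => ?_⟩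
    · rw [hz1, hz2]
      refine ⟨fun h => ?_, fun h => ?_, fun h => ?_⟩
      · obtain ⟨χ, rfl⟩ := hdec x hx hW (by omega)
        cases χ with
        | state a =>
          have ha := lt_pair_right (a := 5) (by norm_num) a.code
          rw [hBc _ _ hx]
          have hWa := ((hty _ hx hW).2.2.2.1 (.inr h)).1
          simp only [PathFormula.code, arg_pair] at hx hWa ⊢
          rw [hT a (by omega) hWa]
          simp [PathFormula.map, LTS.SatPath]
        | _ => simp [PathFormula.code] at h
      · obtain ⟨χ, rfl⟩ := hdec x hx hW (by omega)
        cases χ with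
        | neg a =>
          have ha := lt_pair_right (a := 6) (by norm_num) a.code
          rw [hBc _ _ hx]
          simp only [PathFormula.code, arg_pair] at hx ⊢
          rw [hBc _ _ (by omega)]
          simp [PathFormula.map, LTS.SatPath]
        | _ => simp [PathFormula.code] at h
      · obtain ⟨χ, rfl⟩ := hdec x hx hW (by omega)
        cases χ with
        | and a b =>
          have ha := lt_pair_pair_left (a := 7) (by norm_num) a.code b.code
          have hb := lt_pair_pair_right (a := 7) (by norm_num) a.code b.code
          rw [hBc _ _ hx]
          simp only [PathFormula.code, argL_pair, argR_pair] at hx ⊢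
          rw [hBc _ _ (by omega), hBc _ _ (by omega)]
          simp [PathFormula.map, LTS.SatPath]
        | _ => simp [PathFormula.code] at h
    · obtain ⟨j, hj, h⟩ := Filter.frequently_atTop.1 ((H.fair π).1 hf c hc) (i + 1)
      exact reach_of_seq hZ hzZ hE hj (by rwa [hz1])
    · obtain ⟨χ, rfl⟩ := hdec x hx hW (by omega)
      cases χ with
      | untl a b =>
        have hb := lt_pair_pair_right (a := 8) (by norm_num) a.code b.code
        -- A later node is required: either the until formula is false at the next position, or it
        -- is true there and its right argument holds at some position from there on.
        by_cases hu : M.SatPath F ((PathFormula.untl a b).map f) fun n => π (i + 1 + n)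
        · obtain ⟨j, hj, -⟩ := (satPath_untl_iff M F (a.map f) (b.map f) π (i + 1)).1 hu
          refine reach_of_seq hZ hzZ hE (j := i + 1 + j) (by omega) (.inr ?_)
          rw [hz2]
          simp only [PathFormula.code, argR_pair] at hx ⊢
          exact (hBc _ _ (by omega)).2 hj
        · refine reach_of_seq hZ hzZ hE (j := i + 1) (by omega) (.inl ?_)
          rw [hz2]
          exact fun h => hu ((hBc _ _ hx).1 h)
      | _ => simp [PathFormula.code] at h8
  · rw [hz2, hBc 0 ψ (by omega)]
    simpa using hs

/-- A walk through the witnessing set that serves all acceptance conditions in turn, each infinitely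
often, gives a fair path. By induction on Gödel numbers its nodes contain exactly the true formulas.
-/
theorem path_of_win (H : Represents K M F f enc) {W T : ℕ} {ψ : PathFormula (ℕ × Fin k)}
    (hty : ∀ x < ψ.code + 1, Bit W x → Typed k W x) (hW : Bit W ψ.code)
    (hT : ∀ φ : StateFormula (ℕ × Fin k), φ.code < ψ.code → Bit W φ.code →
      ∀ s, Bit T (Nat.pair φ.code (enc s)) ↔ M.SatState F (φ.map f) s)
    {s : S} (hwin : K.Win ψ.code W T (enc s)) :
    ∃ π : ℕ → S, M.IsPath π ∧ π ∈ F ∧ π 0 = s ∧ M.SatPath F (ψ.map f) π := by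
  set r := ψ.code with hr
  obtain ⟨Z, hZ, hgood, z₀, -, hz₀, hs₀, hr₀⟩ := hwin
  let E : ℕ → ℕ → Prop := fun y y' => Bit Z y' ∧ K.Edge r W y y'
  -- Fairness conditions and until eventualities are collected in one countable family; indices out
  -- of range give vacuous conditions.
  let C : ℕ ⊕ ℕ → ℕ → Prop := Sum.elim (fun i y => i < K.fairCount → K.fair i y.unpair.1)
    fun x y => x < r + 1 → Bit W x → tag x = 8 → ¬ Bit y.unpair.2 x ∨ Bit y.unpair.2 (argR x)
  have hreach : ∀ c z, Bit Z z → ∃ y, TransGen E z y ∧ C c y := by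
    intro c z hz
    obtain ⟨-, -, h1, h2⟩ := hgood z (hz.lt hZ) hz
    -- Vacuous conditions also need a proper continuation. It exists because there is at least one
    -- fairness condition and `Reach` requires a nonempty path.
    have hdef : ∃ y, TransGen E z y := by
      obtain ⟨y, hy, -⟩ := reach_transGen (h1 0 H.fairCount_pos)
      exact ⟨y, hy⟩
    obtain ⟨y₀, hy₀⟩ := hdef
    rcases c with i | x
    · by_cases hi : i < K.fairCount
      · obtain ⟨y, hy, hC⟩ := reach_transGen (h1 i hi)
        exact ⟨y, hy, fun _ => hC⟩
      · exact ⟨y₀, hy₀, fun h => absurd h hi⟩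
    · by_cases hx : x < r + 1 ∧ Bit W x ∧ tag x = 8
      · obtain ⟨y, hy, hC⟩ := reach_transGen (h2 x hx.1 hx.2.1 hx.2.2)
        exact ⟨y, hy, fun _ _ _ => hC⟩
      · exact ⟨y₀, hy₀, fun h h' h'' => absurd ⟨h, h', h''⟩ hx⟩
  have hZE : ∀ {z y}, TransGen E z y → Bit Z y := fun h => by
    cases h with
    | single h => exact h.1
    | tail _ h => exact h.1
  choose nxt hn1 hn2 using hreach
  obtain ⟨e, he⟩ := exists_surjective_nat (ℕ ⊕ ℕ)
  -- Stage `m` serves the condition numbered by the first component of `m.unpair`, so each condition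
  -- is served infinitely often.
  let p : ℕ → {z // Bit Z z} := fun m => Nat.rec ⟨z₀, hz₀⟩
    (fun m z => ⟨nxt (e m.unpair.1) z.1 z.2, hZE (hn1 _ _ _)⟩) m
  obtain ⟨x, τ, hτ, hx0, hxp, hxE⟩ := exists_seq_of_transGen (r := E) (fun m => (p m).1)
    fun m => hn1 (e m.unpair.1) _ _
  have hxZ : ∀ n, Bit Z (x n) := fun n => by
    cases n with
    | zero => rw [hx0]; exact hz₀
    | succ n => exact (hxE n).1
  have hfreq : ∀ c N, ∃ n ≥ N, C c (x n) := by
    intro c N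
    obtain ⟨j, rfl⟩ := he c
    refine ⟨τ (Nat.pair j N + 1), ?_, ?_⟩
    · exact ((Nat.right_le_pair j N).trans (Nat.le_succ _)).trans (hτ.id_le _)
    · rw [hxp]
      have := hn2 (e (Nat.pair j N).unpair.1) (p (Nat.pair j N)).1 (p (Nat.pair j N)).2
      rw [Nat.unpair_pair] at this
      simpa [p] using this
  have hg := fun n => hgood (x n) ((hxZ n).lt hZ) (hxZ n)
  choose π hπ using fun n => H.surj _ (hg n).1
  -- Induction on the code: consistency settles state formulas, negations and conjunctions, and the
  -- edges together with the served eventualities settle until.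
  have key : ∀ N, ∀ χ : PathFormula (ℕ × Fin k), χ.code = N → N < r + 1 → Bit W N → ∀ n,
      (Bit (x n).unpair.2 N ↔ M.SatPath F (χ.map f) fun i => π (n + i)) := by
    intro N
    induction N using Nat.strong_induction_on with
    | _ N ih =>
      rintro χ rfl hlt hWN n
      have hcons := fun n => (hg n).2.1 _ hlt hWN
      obtain ⟨-, -, -, h25, h46, -, h78⟩ := hty _ hlt hWN
      cases χ with
      | state a =>
        have ha := lt_pair_right (a := 5) (by norm_num) a.code
        have h1 := (hcons n).1 (by simp [PathFormula.code])
        have h2 := h25 (.inr (by simp [PathFormula.code]))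
        simp only [PathFormula.code, arg_pair] at h1 h2 hlt ⊢
        rw [h1, ← hπ, hT a (by omega) h2.1]
        simp [PathFormula.map, LTS.SatPath]
      | neg a =>
        have ha := lt_pair_right (a := 6) (by norm_num) a.code
        have h1 := (hcons n).2.1 (by simp [PathFormula.code])
        have h2 := h46 (.inr (by simp [PathFormula.code]))
        simp only [PathFormula.code, arg_pair] at h1 h2 hlt ih ⊢
        rw [h1, ih _ ha a rfl (by omega) h2.1]
        simp [PathFormula.map, LTS.SatPath]
      | and a b =>
        have ha := lt_pair_pair_left (a := 7) (by norm_num) a.code b.code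
        have hb := lt_pair_pair_right (a := 7) (by norm_num) a.code b.code
        have h1 := (hcons n).2.2 (by simp [PathFormula.code])
        have h2 := h78 (.inl (by simp [PathFormula.code]))
        simp only [PathFormula.code, argL_pair, argR_pair] at h1 h2 hlt ih ⊢
        rw [h1, ih _ ha a rfl (by omega) h2.1.1, ih _ hb b rfl (by omega) h2.2.1]
        simp [PathFormula.map, LTS.SatPath]
      | untl a b =>
        have ha := lt_pair_pair_left (a := 8) (by norm_num) a.code b.code
        have hb := lt_pair_pair_right (a := 8) (by norm_num) a.code b.code
        have h8 : tag (PathFormula.untl a b).code = 8 := by simp [PathFormula.code]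
        have h1 := fun n => (hxE n).2.2 _ hlt hWN h8
        have h2 := h78 (.inr h8)
        have h3 : ∀ n, ∃ m ≥ n, _ := fun n =>
          (hfreq (.inr _) n).imp fun m hm => ⟨hm.1, hm.2 hlt hWN h8⟩
        simp only [PathFormula.code, argL_pair, argR_pair] at h1 h2 h3 hlt ih ⊢
        simp only [PathFormula.map]
        rw [satPath_untl_iff, eq_until_of_fixpoint h1 h3 n]
        simp only [Until, ih _ ha a rfl (by omega) h2.1.1, ih _ hb b rfl (by omega) h2.2.1]
  refine ⟨π, fun n => ?_, (H.fair π).2 fun i hi => ?_, ?_, ?_⟩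
  · rw [← H.step, hπ, hπ]
    exact (hxE n).2.1
  · refine Filter.frequently_atTop.2 fun N => ?_
    obtain ⟨n, hn, h⟩ := hfreq (.inl i) N
    exact ⟨n, hn, by rw [hπ]; exact h hi⟩
  · apply H.inj
    rw [hπ, hx0, ← hs₀]
    rfl
  · have := (key r ψ rfl (by omega) hW 0).1 (by rw [hx0]; exact hr₀)
    simpa using this

/-- `Correct` is a recursion on the components of formulas, so every guessed table that satisfies it
on `W` agrees there with the truth. -/
theorem correct_iff (H : Represents K M F f enc) {W T m : ℕ}
    (hty : ∀ x < m + 1, Bit W x → Typed k W x ∧ K.Correct W T x) :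
    ∀ N, ∀ φ : StateFormula (ℕ × Fin k), φ.code = N → N < m + 1 → Bit W N → ∀ s,
      (Bit T (Nat.pair N (enc s)) ↔ M.SatState F (φ.map f) s) := by
  intro N
  induction N using Nat.strong_induction_on with
  | _ N ih =>
    rintro φ rfl hlt hWN s
    obtain ⟨⟨-, -, -, h25, h46, h3', -⟩, hC⟩ := hty _ hlt hWN
    obtain ⟨h0, h1, h2, h3, h4⟩ := hC (enc s) (H.lt s)
    cases φ with
    | tt =>
      simpa [StateFormula.map, LTS.SatState] using h0 (by simp [StateFormula.code])
    | atom x =>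
      have h1 := h1 (by simp [StateFormula.code])
      simp only [StateFormula.code, argL_pair, argR_pair] at h1 ⊢
      rw [h1, H.label]
      simp [StateFormula.map, LTS.SatState]
    | neg a =>
      have ha := lt_pair_right (a := 2) (by norm_num) a.code
      have h2 := h2 (by simp [StateFormula.code])
      have h5 := h25 (.inl (by simp [StateFormula.code]))
      simp only [StateFormula.code, arg_pair] at h2 h5 hlt ih ⊢
      rw [h2, ih _ ha a rfl (by omega) h5.1]
      simp [StateFormula.map, LTS.SatState]
    | and a b =>
      have ha := lt_pair_pair_left (a := 3) (by norm_num) a.code b.code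
      have hb := lt_pair_pair_right (a := 3) (by norm_num) a.code b.code
      have h3 := h3 (by simp [StateFormula.code])
      have h5 := h3' (by simp [StateFormula.code])
      simp only [StateFormula.code, argL_pair, argR_pair] at h3 h5 hlt ih ⊢
      rw [h3, ih _ ha a rfl (by omega) h5.1.1, ih _ hb b rfl (by omega) h5.2.1]
      simp [StateFormula.map, LTS.SatState]
    | ex ψ =>
      have ha := lt_pair_right (a := 4) (by norm_num) ψ.code
      have h4 := h4 (by simp [StateFormula.code])
      have h5 := h46 (.inl (by simp [StateFormula.code]))
      simp only [StateFormula.code, arg_pair] at h4 h5 hlt ih ⊢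
      have hty' : ∀ x < ψ.code + 1, Bit W x → Typed k W x := fun x hx hxW =>
        (hty x (by omega) hxW).1
      have hT : ∀ φ : StateFormula (ℕ × Fin k), φ.code < ψ.code → Bit W φ.code →
          ∀ s, Bit T (Nat.pair φ.code (enc s)) ↔ M.SatState F (φ.map f) s :=
        fun φ hφ hWφ => ih _ (by omega) φ rfl (by omega) hWφ
      rw [h4]
      simp only [StateFormula.map, LTS.SatState]
      constructor
      · exact H.path_of_win hty' h5.1 hT
      · rintro ⟨π, hp, hf, rfl, hs⟩
        exact H.win_of_path hty' hT hp hf hs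

/-- Numerical model checking is correct. -/
theorem check_iff (H : Represents K M F f enc) (φ : StateFormula (ℕ × Fin k)) (s : S) :
    K.Check k φ.code (enc s) ↔ M.SatState F (φ.map f) s := by
  constructor
  · rintro ⟨W, -, T, -, hW, hty, hT⟩
    exact (H.correct_iff hty _ φ rfl (by omega) hW s).1 hT
  intro hs
  set m := φ.code with hm
  -- All formulas with Gödel number at most `m` are taken, not just the subformulas of `φ`; this set
  -- is closed under components.
  obtain ⟨W, hW, hWm⟩ := exists_bits (m + 1) fun x =>
    (∃ χ : StateFormula (ℕ × Fin k), χ.code = x) ∨ ∃ χ : PathFormula (ℕ × Fin k), χ.code = x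
  obtain ⟨T, hT, hTm⟩ := exists_bits ((m + K.size + 1) * (m + K.size + 1)) fun y =>
    ∃ (χ : StateFormula (ℕ × Fin k)) (s : S),
      Nat.pair χ.code (enc s) = y ∧ M.SatState F (χ.map f) s
  have hWs : ∀ χ : StateFormula (ℕ × Fin k), χ.code < m + 1 → Bit W χ.code :=
    fun χ h => (hWm _).2 ⟨h, .inl ⟨χ, rfl⟩⟩
  have hWp : ∀ χ : PathFormula (ℕ × Fin k), χ.code < m + 1 → Bit W χ.code :=
    fun χ h => (hWm _).2 ⟨h, .inr ⟨χ, rfl⟩⟩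
  have hTc : ∀ χ : StateFormula (ℕ × Fin k), χ.code < m + 1 → ∀ s,
      (Bit T (Nat.pair χ.code (enc s)) ↔ M.SatState F (χ.map f) s) := by
    intro χ hχ s
    rw [hTm]
    constructor
    · rintro ⟨-, χ', s', he, h⟩
      obtain ⟨h1, h2⟩ := Nat.pair_eq_pair.1 he
      rwa [← StateFormula.code_inj _ _ h1, ← H.inj h2]
    · refine fun h => ⟨(Nat.pair_lt_max_add_one_sq _ _).trans_le ?_, χ, s, rfl, h⟩
      have h1 := H.lt s
      rw [sq]
      apply Nat.mul_self_le_mul_self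
      omega
  have tags : ∀ χ : StateFormula (ℕ × Fin k), tag χ.code < 5 := fun χ => by
    cases χ <;> simp [StateFormula.code]
  have tagp : ∀ χ : PathFormula (ℕ × Fin k), ¬ tag χ.code < 5 := fun χ => by
    cases χ <;> simp [PathFormula.code]
  have hty : ∀ x < m + 1, Bit W x → Typed k W x := by
    intro x hx hxW
    rcases ((hWm x).1 hxW).2 with ⟨χ, rfl⟩ | ⟨χ, rfl⟩
    · cases χ with
      | tt => simp [Typed, StateFormula.code]
      | atom x => simp [Typed, StateFormula.code]
      | neg a =>
        have ha := lt_pair_right (a := 2) (by norm_num) a.code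
        simp only [StateFormula.code] at hx
        simp [Typed, StateFormula.code, tags, hWs a (by omega)]
      | and a b =>
        have ha := lt_pair_pair_left (a := 3) (by norm_num) a.code b.code
        have hb := lt_pair_pair_right (a := 3) (by norm_num) a.code b.code
        simp only [StateFormula.code] at hx
        simp [Typed, StateFormula.code, tags, hWs a (by omega), hWs b (by omega)]
      | ex a =>
        have ha := lt_pair_right (a := 4) (by norm_num) a.code
        simp only [StateFormula.code] at hx
        simpa [Typed, StateFormula.code, hWp a (by omega)] using tagp a
    · cases χ with
      | state a =>
        have ha := lt_pair_right (a := 5) (by norm_num) a.code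
        simp only [PathFormula.code] at hx
        simp [Typed, PathFormula.code, tags, hWs a (by omega)]
      | neg a =>
        have ha := lt_pair_right (a := 6) (by norm_num) a.code
        simp only [PathFormula.code] at hx
        simpa [Typed, PathFormula.code, hWp a (by omega)] using tagp a
      | and a b =>
        have ha := lt_pair_pair_left (a := 7) (by norm_num) a.code b.code
        have hb := lt_pair_pair_right (a := 7) (by norm_num) a.code b.code
        simp only [PathFormula.code] at hx
        simpa [Typed, PathFormula.code, hWp a (by omega), hWp b (by omega)] using
          And.intro (tagp a) (tagp b)
      | untl a b =>
        have ha := lt_pair_pair_left (a := 8) (by norm_num) a.code b.code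
        have hb := lt_pair_pair_right (a := 8) (by norm_num) a.code b.code
        simp only [PathFormula.code] at hx
        simpa [Typed, PathFormula.code, hWp a (by omega), hWp b (by omega)] using
          And.intro (tagp a) (tagp b)
  refine ⟨W, hW, T, hT, hWs φ (by omega), fun x hx hxW => ⟨hty x hx hxW, ?_⟩,
    (hTc φ (by omega) s).2 hs⟩
  intro j hj
  obtain ⟨s, rfl⟩ := H.surj j hj
  rcases ((hWm x).1 hxW).2 with ⟨χ, rfl⟩ | ⟨χ, rfl⟩
  · rw [hTc χ hx]
    cases χ with
    | tt => simp [StateFormula.code, StateFormula.map, LTS.SatState]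
    | atom x => simp [StateFormula.code, StateFormula.map, LTS.SatState, H.label]
    | neg a =>
      have ha := lt_pair_right (a := 2) (by norm_num) a.code
      simp only [StateFormula.code] at hx
      simp [StateFormula.code, StateFormula.map, LTS.SatState, hTc a (by omega)]
    | and a b =>
      have ha := lt_pair_pair_left (a := 3) (by norm_num) a.code b.code
      have hb := lt_pair_pair_right (a := 3) (by norm_num) a.code b.code
      simp only [StateFormula.code] at hx
      simp [StateFormula.code, StateFormula.map, LTS.SatState, hTc a (by omega),
        hTc b (by omega)]
    | ex a =>
      have ha := lt_pair_right (a := 4) (by norm_num) a.code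
      simp only [StateFormula.code] at hx
      have hty' : ∀ x < a.code + 1, Bit W x → Typed k W x := fun x hx' hxW =>
        hty x (by omega) hxW
      have hT' : ∀ φ : StateFormula (ℕ × Fin k), φ.code < a.code → Bit W φ.code →
          ∀ s, Bit T (Nat.pair φ.code (enc s)) ↔ M.SatState F (φ.map f) s :=
        fun φ hφ _ => hTc φ (by omega)
      simp only [StateFormula.code, tag_pair, arg_pair, StateFormula.map, LTS.SatState]
      refine ⟨by simp, by simp, by simp, by simp, fun _ => ⟨?_,
        H.path_of_win hty' (hWp a (by omega)) hT'⟩⟩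
      rintro ⟨π, hp, hf, rfl, hs⟩
      exact H.win_of_path hty' hT' hp hf hs
  -- The table is not constrained at path formulas.
  · have := tagp χ
    refine ⟨?_, ?_, ?_, ?_, ?_⟩ <;> intro h <;> omega

end Represents

end TokenPassing

namespace TokenPassing

/-! ## Numerical model checking is primitive recursive -/

namespace Prim

variable {α β : Type} [Primcodable α] [Primcodable β]

/-- The closure properties are stated pointwise, so that a predicate built from bounded quantifiers
and connectives can be taken apart by following its syntax. -/
theorem self : Primrec fun a : α => a := Primrec.id

theorem const (b : β) : Primrec fun _ : α => b := Primrec.const b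

theorem fst {γ : Type} [Primcodable γ] {f : α → β × γ} (hf : Primrec f) :
    Primrec fun a => (f a).1 := Primrec.fst.comp hf

theorem snd {γ : Type} [Primcodable γ] {f : α → β × γ} (hf : Primrec f) :
    Primrec fun a => (f a).2 := Primrec.snd.comp hf

section

variable {f g : α → ℕ}

theorem add (hf : Primrec f) (hg : Primrec g) : Primrec fun a => f a + g a :=
  Primrec.nat_add.comp hf hg

theorem mul (hf : Primrec f) (hg : Primrec g) : Primrec fun a => f a * g a :=
  Primrec.nat_mul.comp hf hg

theorem div (hf : Primrec f) (hg : Primrec g) : Primrec fun a => f a / g a :=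
  Primrec.nat_div.comp hf hg

theorem mod (hf : Primrec f) (hg : Primrec g) : Primrec fun a => f a % g a :=
  Primrec.nat_mod.comp hf hg

theorem pow (hf : Primrec f) (hg : Primrec g) : Primrec fun a => f a ^ g a :=
  Primrec₂.comp (f := fun a b : ℕ => a ^ b) (Primrec₂.unpaired'.1 Nat.Primrec.pow) hf hg

theorem natPair (hf : Primrec f) (hg : Primrec g) : Primrec fun a => Nat.pair (f a) (g a) :=
  Primrec₂.natPair.comp hf hg

theorem unpair (hf : Primrec f) : Primrec fun a => (f a).unpair :=
  Primrec.unpair.comp hf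

theorem tag (hf : Primrec f) : Primrec fun a => tag (f a) := fst (unpair hf)

theorem arg (hf : Primrec f) : Primrec fun a => arg (f a) := snd (unpair hf)

theorem argL (hf : Primrec f) : Primrec fun a => argL (f a) := fst (unpair (snd (unpair hf)))

theorem argR (hf : Primrec f) : Primrec fun a => argR (f a) := snd (unpair (snd (unpair hf)))

theorem lt (hf : Primrec f) (hg : Primrec g) : PrimrecPred fun a => f a < g a :=
  Primrec.nat_lt.comp hf hg

theorem bit (hf : Primrec f) (hg : Primrec g) : PrimrecPred fun a => Bit (f a) (g a) :=
  (Primrec.eq.comp (mod (div hf (pow (const 2) hg)) (const 2)) (const 1)).of_eq fun a => by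
    simp [Bit, Nat.testBit_eq_decide_div_mod_eq]

end

theorem eq {f g : α → β} (hf : Primrec f) (hg : Primrec g) : PrimrecPred fun a => f a = g a :=
  Primrec.eq.comp hf hg

section

variable {p q : α → Prop}

theorem not (hp : PrimrecPred p) : PrimrecPred fun a => ¬ p a := PrimrecPred.not hp

theorem and (hp : PrimrecPred p) (hq : PrimrecPred q) : PrimrecPred fun a => p a ∧ q a :=
  PrimrecPred.and hp hq

theorem or (hp : PrimrecPred p) (hq : PrimrecPred q) : PrimrecPred fun a => p a ∨ q a :=
  PrimrecPred.or hp hq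

theorem imp (hp : PrimrecPred p) (hq : PrimrecPred q) : PrimrecPred fun a => p a → q a :=
  (or (not hp) hq).of_eq fun _ => imp_iff_not_or.symm

theorem iff (hp : PrimrecPred p) (hq : PrimrecPred q) : PrimrecPred fun a => p a ↔ q a :=
  (and (imp hp hq) (imp hq hp)).of_eq fun _ => iff_def.symm

end

theorem bex_mem {p : α → β → Prop} {f : α → List β} (hf : Primrec f)
    (hp : PrimrecPred fun x : α × β => p x.1 x.2) : PrimrecPred fun a => ∃ x ∈ f a, p a x :=
  PrimrecRel.comp (PrimrecRel.exists_mem_list (R := fun x a => p a x)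
    (hp.comp (Primrec.pair Primrec.snd Primrec.fst))) hf Primrec.id

theorem mem {f : α → β} {g : α → List β} (hf : Primrec f) (hg : Primrec g) :
    PrimrecPred fun a => f a ∈ g a :=
  (bex_mem (p := fun a x => f a = x) hg (eq (hf.comp Primrec.fst) Primrec.snd)).of_eq
    fun _ => by simp

variable {p : α → ℕ → Prop} {f : α → ℕ}

theorem bex (hf : Primrec f) (hp : PrimrecPred fun x : α × ℕ => p x.1 x.2) :
    PrimrecPred fun a => ∃ x < f a, p a x :=
  (bex_mem (Primrec.list_range.comp hf) hp).of_eq fun _ => by simp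

theorem ball (hf : Primrec f) (hp : PrimrecPred fun x : α × ℕ => p x.1 x.2) :
    PrimrecPred fun a => ∀ x < f a, p a x :=
  (not (bex (p := fun a x => ¬ p a x) hf (not hp))).of_eq fun _ => by simp

end Prim

namespace NumSystem

variable {α : Type} [Primcodable α]

open Prim

theorem primrecPred_typed {k W x : α → ℕ} (hk : Primrec k) (hW : Primrec W) (hx : Primrec x) :
    PrimrecPred fun a => Typed (k a) (W a) (x a) := by
  unfold Typed
  repeat' with_reducible first
    | assumption | apply Prim.const | apply Prim.iff | apply Prim.and | apply Prim.or | apply Prim.not | apply Prim.imp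
    | apply Prim.eq | apply Prim.lt | apply Prim.bit | apply Prim.tag | apply Prim.arg
    | apply Prim.argL | apply Prim.argR

theorem primrecPred_consistent {r W T z : α → ℕ} (hr : Primrec r) (hW : Primrec W)
    (hT : Primrec T) (hz : Primrec z) :
    PrimrecPred fun a => Consistent (r a) (W a) (T a) (z a) := by
  unfold Consistent
  repeat' with_reducible first
    | assumption | apply Prim.const | apply Prim.self | apply Prim.ball | apply Prim.iff | apply Prim.and | apply Prim.not
    | apply Prim.imp | apply Prim.eq | apply Prim.bit | apply Prim.add | apply Prim.natPair | apply Prim.tag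
    | apply Prim.arg | apply Prim.argL | apply Prim.argR | apply hW.comp | apply hT.comp
    | apply hz.comp | apply Prim.fst | apply Prim.snd | apply Prim.unpair

/-- The components of the systems `K a` are primitive recursive in `a`. -/
structure IsPrimrec (K : α → NumSystem) : Prop where
  size : Primrec fun a => (K a).size
  fairCount : Primrec fun a => (K a).fairCount
  step : PrimrecPred fun x : α × ℕ × ℕ => (K x.1).step x.2.1 x.2.2
  label : PrimrecPred fun x : α × ℕ × ℕ × ℕ => (K x.1).label x.2.1 x.2.2.1 x.2.2.2
  fair : PrimrecPred fun x : α × ℕ × ℕ => (K x.1).fair x.2.1 x.2.2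

namespace IsPrimrec

variable {K : α → NumSystem}

theorem comp {β : Type} [Primcodable β] (h : IsPrimrec K) {f : β → α} (hf : Primrec f) :
    IsPrimrec fun b => K (f b) where
  size := h.size.comp hf
  fairCount := h.fairCount.comp hf
  step := h.step.comp ((hf.comp Primrec.fst).pair Primrec.snd)
  label := h.label.comp ((hf.comp Primrec.fst).pair Primrec.snd)
  fair := h.fair.comp ((hf.comp Primrec.fst).pair Primrec.snd)

variable (h : IsPrimrec K) {r W T Z s z z' k m : α → ℕ}

include h

theorem step' (hz : Primrec z) (hz' : Primrec z') :
    PrimrecPred fun a => (K a).step (z a) (z' a) :=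
  h.step.comp (Primrec.id.pair (hz.pair hz'))

theorem label' (hr : Primrec r) (hz : Primrec z) (hz' : Primrec z') :
    PrimrecPred fun a => (K a).label (r a) (z a) (z' a) :=
  h.label.comp (Primrec.id.pair (hr.pair (hz.pair hz')))

theorem fair' (hz : Primrec z) (hz' : Primrec z') :
    PrimrecPred fun a => (K a).fair (z a) (z' a) :=
  h.fair.comp (Primrec.id.pair (hz.pair hz'))

theorem edge (hr : Primrec r) (hW : Primrec W) (hz : Primrec z) (hz' : Primrec z') :
    PrimrecPred fun a => (K a).Edge (r a) (W a) (z a) (z' a) := by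
  refine Prim.and (h.step' (Prim.fst (Prim.unpair hz)) (Prim.fst (Prim.unpair hz'))) ?_
  repeat' with_reducible first
    | assumption | apply Prim.const | apply Prim.self | apply Prim.ball | apply Prim.iff
    | apply Prim.and | apply Prim.or | apply Prim.imp | apply Prim.eq | apply Prim.bit
    | apply Prim.add | apply Prim.tag | apply Prim.argL | apply Prim.argR
    | apply hW.comp | apply hz.comp | apply hz'.comp
    | apply Prim.fst | apply Prim.snd | apply Prim.unpair

theorem nodes (hr : Primrec r) : Primrec fun a => (K a).nodes (r a) := by
  have hs := h.size
  unfold NumSystem.nodes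
  repeat' with_reducible first
    | assumption | apply Prim.const | apply Prim.add | apply Prim.mul | apply Prim.pow

theorem reach {C : α → ℕ → Prop} (hr : Primrec r) (hW : Primrec W) (hZ : Primrec Z)
    (hz : Primrec z) (hC : PrimrecPred fun x : α × ℕ => C x.1 x.2) :
    PrimrecPred fun a => (K a).Reach (r a) (W a) (Z a) (z a) (C a) := by
  -- Each bounded quantifier enlarges the type of parameters, so the hypothesis is needed under
  -- arbitrary substitutions.
  have hC' : ∀ {β : Type} [Primcodable β] {f : β → α} {g : β → ℕ}, Primrec f → Primrec g →
      PrimrecPred fun b => C (f b) (g b) := fun hf hg => hC.comp (hf.pair hg)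
  unfold Reach
  repeat' with_reducible first
    | assumption | apply Prim.const | apply Prim.self | apply Prim.ball | apply Prim.bex
    | apply Prim.and | apply Prim.imp | apply Prim.bit | apply IsPrimrec.edge | apply h.comp
    | apply Prim.pow | apply IsPrimrec.nodes | apply hC' | apply hr.comp | apply hW.comp
    | apply hZ.comp | apply hz.comp | apply Prim.fst | apply Prim.snd

theorem win (hr : Primrec r) (hW : Primrec W) (hT : Primrec T) (hs : Primrec s) :
    PrimrecPred fun a => (K a).Win (r a) (W a) (T a) (s a) := by
  have hn := h.size
  have hc := h.fairCount
  unfold Win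
  repeat' with_reducible first
    | assumption | apply Prim.const | apply Prim.self | apply Prim.ball | apply Prim.bex
    | apply Prim.and | apply Prim.or | apply Prim.not | apply Prim.imp | apply Prim.bit
    | apply Prim.eq | apply Prim.lt | apply primrecPred_consistent
    | apply IsPrimrec.reach | apply IsPrimrec.fair' | apply h.comp
    | apply Prim.pow | apply IsPrimrec.nodes | apply hr.comp | apply hW.comp
    | apply hT.comp | apply hs.comp | apply hn.comp | apply hc.comp | apply Prim.add
    | apply Prim.tag | apply Prim.argR | apply Prim.unpair | apply Prim.fst | apply Prim.snd

theorem correct (hW : Primrec W) (hT : Primrec T) (hz : Primrec z) :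
    PrimrecPred fun a => (K a).Correct (W a) (T a) (z a) := by
  have hn := h.size
  unfold Correct
  repeat' with_reducible first
    | assumption | apply Prim.const | apply Prim.self | apply Prim.ball | apply Prim.iff
    | apply Prim.and | apply Prim.not | apply Prim.imp | apply Prim.bit | apply Prim.eq
    | apply IsPrimrec.win | apply IsPrimrec.label' | apply h.comp | apply Prim.natPair
    | apply hW.comp | apply hT.comp | apply hz.comp | apply hn.comp | apply Prim.tag
    | apply Prim.arg | apply Prim.argL | apply Prim.argR | apply Prim.fst | apply Prim.snd

theorem check (hk : Primrec k) (hm : Primrec m) (hs : Primrec s) :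
    PrimrecPred fun a => (K a).Check (k a) (m a) (s a) := by
  have hn := h.size
  unfold Check
  repeat' with_reducible first
    | assumption | apply Prim.const | apply Prim.self | apply Prim.ball | apply Prim.bex
    | apply Prim.and | apply Prim.imp | apply Prim.bit | apply primrecPred_typed
    | apply IsPrimrec.correct | apply h.comp | apply Prim.natPair
    | apply hk.comp | apply hm.comp | apply hs.comp | apply hn.comp
    | apply Prim.add | apply Prim.mul | apply Prim.pow | apply Prim.fst | apply Prim.snd

end IsPrimrec

end NumSystem

/-! ## Deciding the parameterized model checking problem -/

/-- A digit of `s` in base `b`. -/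
def digit (b s i : ℕ) : ℕ := s / b ^ i % b

theorem digit_finFunctionFinEquiv {b n : ℕ} (s : Fin n → Fin b) (i : Fin n) :
    digit b (finFunctionFinEquiv s) i = s i :=
  congrArg Fin.val (congrFun (finFunctionFinEquiv.symm_apply_apply s) i)

/-- The numerical description of a token-passing system with `n` processes and edge relation `E`,
where `g` is the assignment of vertices to index variables, and global states and assignments are
numbers in base the number of local states and `n`, respectively. -/
def numSystem (E : ℕ → ℕ → Prop) (c : TemplateCode) (n g : ℕ) : NumSystem where
  size := c.1 ^ n
  fairCount := n
  step s s' :=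
    (∃ i < n, (∃ a < c.2.1, (digit c.1 s i, a + 2, digit c.1 s' i) ∈ c.2.2.2.2.2.1) ∧
      ∀ j < n, ¬ j = i → digit c.1 s j = digit c.1 s' j) ∨
    ∃ i < n, ∃ j < n, E i j ∧ (digit c.1 s i, 0, digit c.1 s' i) ∈ c.2.2.2.2.2.1 ∧
      (digit c.1 s j, 1, digit c.1 s' j) ∈ c.2.2.2.2.2.1 ∧
      ∀ l < n, ¬ l = i → ¬ l = j → digit c.1 s' l = digit c.1 s l
  label p i s := (digit c.1 s (digit n g i), p) ∈ c.2.2.2.2.2.2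
  fair i s := digit c.1 s i ∈ c.2.2.1

/-- The guard with the given code holds for the variable `i` under the assignment `g`. -/
def GuardHolds (E : ℕ → ℕ → Prop) (n g i : ℕ) (e : ℕ × List ℕ) : Prop :=
  (e.1 = 1 → ∃ y ∈ e.2, digit n g i = digit n g y) ∧
    (e.1 = 2 → E (digit n g (e.2.getD 0 0)) (digit n g i))

/-- The algorithm for the parameterized model checking problem: all members of a family of
topologies up to the cutoff are checked. The family consists of the topologies of size `n` in `V`
with edge relation `E n h` for some `h`. -/
def Decide (V : ℕ → Prop) (E : ℕ → ℕ → ℕ → ℕ → Prop) (x : FormulaCode × TemplateCode) : Prop :=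
  ∀ n < 2 * x.1.1 + 3, V n → ∀ h < n, ∀ v < n, ∀ g < n ^ x.1.1,
    (∀ i < x.1.1, GuardHolds (E n h) n g i (x.1.2.1.getD i (0, []))) →
    ∀ s < x.2.1 ^ n, (∀ i < n, (i = v → digit x.2.1 s i = x.2.2.2.2.1) ∧
      (¬ i = v → digit x.2.1 s i = x.2.2.2.2.2.1)) →
    (numSystem (E n h) x.2 n g).Check x.1.1 x.1.2.2 s

section

variable {α : Type} [Primcodable α]

theorem Prim.digit {b s i : α → ℕ} (hb : Primrec b) (hs : Primrec s) (hi : Primrec i) :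
    Primrec fun a => digit (b a) (s a) (i a) :=
  Prim.mod (Prim.div hs (Prim.pow hb hi)) hb

theorem isPrimrec_numSystem {E : α → ℕ → ℕ → Prop} {c : α → TemplateCode} {n g : α → ℕ}
    (hE : PrimrecPred fun x : α × ℕ × ℕ => E x.1 x.2.1 x.2.2) (hc : Primrec c) (hn : Primrec n)
    (hg : Primrec g) : NumSystem.IsPrimrec fun a => numSystem (E a) (c a) (n a) (g a) := by
  have hE' : ∀ {β : Type} [Primcodable β] {f : β → α} {x y : β → ℕ}, Primrec f → Primrec x →
      Primrec y → PrimrecPred fun b => E (f b) (x b) (y b) :=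
    fun hf hx hy => hE.comp (hf.pair (hx.pair hy))
  constructor <;> dsimp only [numSystem]
  all_goals
    repeat' with_reducible first
      | assumption | apply Prim.const | apply Prim.self | apply Prim.ball | apply Prim.bex
      | apply Prim.and | apply Prim.or | apply Prim.not | apply Prim.imp | apply Prim.eq
      | apply Prim.mem | apply hE' | apply Prim.digit | apply Prim.add | apply Prim.pow
      | apply hc.comp | apply hn.comp | apply hg.comp | apply Prim.fst | apply Prim.snd
      | apply Primrec.pair

theorem primrecPred_guardHolds {E : α → ℕ → ℕ → Prop} {n g i : α → ℕ} {e : α → ℕ × List ℕ}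
    (hE : PrimrecPred fun x : α × ℕ × ℕ => E x.1 x.2.1 x.2.2) (hn : Primrec n)
    (hg : Primrec g) (hi : Primrec i) (he : Primrec e) :
    PrimrecPred fun a => GuardHolds (E a) (n a) (g a) (i a) (e a) := by
  refine Prim.and (Prim.imp (Prim.eq (Prim.fst he) (Prim.const 1)) ?_)
    (Prim.imp (Prim.eq (Prim.fst he) (Prim.const 2)) ?_)
  · refine Prim.bex_mem (Prim.snd he) (Prim.eq ?_ ?_)
    · exact Prim.digit (hn.comp Primrec.fst) (hg.comp Primrec.fst) (hi.comp Primrec.fst)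
    · exact Prim.digit (hn.comp Primrec.fst) (hg.comp Primrec.fst) Primrec.snd
  · exact hE.comp (Primrec.id.pair ((Prim.digit hn hg
      ((Primrec.list_getD 0).comp (Prim.snd he) (Prim.const 0))).pair (Prim.digit hn hg hi)))

theorem primrecPred_decide {V : ℕ → Prop} {E : ℕ → ℕ → ℕ → ℕ → Prop} (hV : PrimrecPred V)
    (hE : PrimrecPred fun x : ℕ × ℕ × ℕ × ℕ => E x.1 x.2.1 x.2.2.1 x.2.2.2) :
    PrimrecPred (Decide V E) := by
  have hE' : ∀ {β : Type} [Primcodable β] {n h x y : β → ℕ}, Primrec n → Primrec h → Primrec x →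
      Primrec y → PrimrecPred fun b => E (n b) (h b) (x b) (y b) :=
    fun hn hh hx hy => hE.comp (hn.pair (hh.pair (hx.pair hy)))
  have hget : ∀ {β : Type} [Primcodable β] {l : β → List (ℕ × List ℕ)} {i : β → ℕ}, Primrec l →
      Primrec i → Primrec fun b => (l b).getD (i b) (0, []) :=
    fun hl hi => (Primrec.list_getD (0, [])).comp hl hi
  unfold Decide
  repeat' with_reducible first
    | assumption | apply Prim.const | apply Prim.self | apply Prim.ball | apply Prim.and
    | apply Prim.not | apply Prim.imp | apply Prim.eq | apply primrecPred_guardHolds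
    | apply NumSystem.IsPrimrec.check | apply isPrimrec_numSystem | apply hE' | apply hV.comp
    | apply hget | apply Prim.digit | apply Prim.add | apply Prim.mul | apply Prim.pow
    | apply Prim.fst | apply Prim.snd

end

end TokenPassing

namespace TokenPassing

-- The numerical description represents the token-passing system.

section

variable {q a k : ℕ} {P : ProcessTemplate (Fin q) (Fin a)} {c : TemplateCode} {G : Topology}
  {E : ℕ → ℕ → Prop}

/-- `finFunctionFinEquiv` is positional notation, so `digit` recovers the local states from the
number of a global state, and the vertices from the number of an assignment. -/
theorem represents_numSystem (hc : Describes c P) (hE : ∀ i j, G.edge i j ↔ E i j)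
    (g : Fin k → Fin G.size) :
    Represents (numSystem E c G.size (finFunctionFinEquiv g)) (system P G) (fairRuns P G)
      (fun x : ℕ × Fin k => (x.1, g x.2)) fun s => (finFunctionFinEquiv s : ℕ) := by
  obtain ⟨nq, na, tok, ιt, ιn, δ, lab⟩ := c
  obtain ⟨rfl, rfl, htok, -, -, hδ, hlab⟩ := hc
  have hd := fun (s : Fin G.size → Fin nq) i => digit_finFunctionFinEquiv s i
  have hd' : ∀ (s : Fin G.size → Fin nq) i (hi : i < G.size),
      digit nq (finFunctionFinEquiv s) i = s ⟨i, hi⟩ := fun s i hi => hd s ⟨i, hi⟩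
  refine ⟨fun s s' h => finFunctionFinEquiv.injective (Fin.ext h), fun s => Fin.is_lt _,
    fun j hj => ⟨finFunctionFinEquiv.symm ⟨j, hj⟩, by simp only [Equiv.apply_symm_apply]⟩,
    G.init.pos, fun s s' => ?_, fun p i s => ?_, fun π => ?_⟩
  · constructor
    · rintro (⟨i, hi, ⟨x, hx, h⟩, hr⟩ | ⟨i, hi, j, hj, hij, h1, h2, hr⟩)
      · simp only [hd' _ i hi] at h
        refine ⟨.int ⟨x, hx⟩, ⟨i, hi⟩, (hδ _ _ _).1 h, fun j hj => Fin.ext ?_⟩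
        have := hr j j.2 fun e => hj (Fin.ext e)
        rwa [hd, hd] at this
      · simp only [hd' _ i hi, hd' _ j hj] at h1 h2
        refine ⟨.tok, ⟨i, hi⟩, ⟨j, hj⟩, (hE _ _).2 hij, (hδ _ _ _).1 h1, (hδ _ _ _).1 h2,
          fun l hl hl' => Fin.ext ?_⟩
        have := hr l l.2 (fun e => hl (Fin.ext e)) fun e => hl' (Fin.ext e)
        rwa [hd, hd] at this
    · rintro ⟨x | _, h⟩
      · obtain ⟨i, h, hr⟩ := h
        refine .inl ⟨i, i.2, ⟨x, x.2, ?_⟩, fun j hj hji => ?_⟩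
        · simp only [hd]
          exact (hδ _ _ _).2 h
        · rw [hd' _ j hj, hd' _ j hj, hr ⟨j, hj⟩ fun e => hji (congrArg Fin.val e)]
      · obtain ⟨i, j, hij, h1, h2, hr⟩ := h
        refine .inr ⟨i, i.2, j, j.2, (hE _ _).1 hij, ?_, ?_, fun l hl hli hlj => ?_⟩
        · simp only [hd]
          exact (hδ _ _ _).2 h1
        · simp only [hd]
          exact (hδ _ _ _).2 h2
        · rw [hd' _ l hl, hd' _ l hl, hr ⟨l, hl⟩ (fun e => hli (congrArg Fin.val e))
            fun e => hlj (congrArg Fin.val e)]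
  · show (digit nq _ (digit G.size _ i), p) ∈ lab ↔ p ∈ P.label (s (g i))
    rw [digit_finFunctionFinEquiv g, hd, hlab]
  · show (∀ i, ∃ᶠ t in Filter.atTop, π t i ∈ P.token) ↔
      ∀ i < G.size, ∃ᶠ t in Filter.atTop, digit nq (finFunctionFinEquiv (π t)) i ∈ tok
    constructor
    · intro h i hi
      simpa only [hd' _ i hi, htok] using h ⟨i, hi⟩
    · intro h i
      simpa only [hd, htok] using h i i.2

theorem guardHolds_iff (hE : ∀ i j, G.edge i j ↔ E i j) (g : Fin k → Fin G.size)
    (Φ : UnivFormula k) :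
    (∀ i < k, GuardHolds E G.size (finFunctionFinEquiv g) i
        ((List.ofFn fun i => (Φ.guard i).code).getD i (0, []))) ↔
      ∀ i : Fin k, (Φ.guard i).Holds G (fun j => g (Fin.castLE i.isLt.le j)) (g i) := by
  have hg := fun i => digit_finFunctionFinEquiv g i
  have key : ∀ i : Fin k, GuardHolds E G.size (finFunctionFinEquiv g) i (Φ.guard i).code ↔
      (Φ.guard i).Holds G (fun j => g (Fin.castLE i.isLt.le j)) (g i) := by
    intro i
    have hg' : ∀ y : Fin i, digit G.size (finFunctionFinEquiv g) y =
        g (Fin.castLE i.isLt.le y) := fun y => hg (Fin.castLE i.isLt.le y)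
    have hgi := hg i
    generalize (finFunctionFinEquiv g : ℕ) = γ at hgi hg' ⊢
    cases Φ.guard i with
    | none => simp [GuardHolds, Guard.code, Guard.Holds]
    | mem Y => simp [GuardHolds, Guard.code, Guard.Holds, hgi, hg', Fin.ext_iff]
    | edge y => simp [GuardHolds, Guard.code, Guard.Holds, hgi, hg', hE]
  constructor
  · intro h i
    have := h i i.2
    rw [← key]
    simpa [List.getD_eq_getElem] using this
  · intro h i hi
    have := (key ⟨i, hi⟩).2 (h ⟨i, hi⟩)
    simpa [List.getD_eq_getElem, hi] using this

theorem digits_init_iff (hc : Describes c P) (s : Fin G.size → Fin q) :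
    (∀ i < G.size, (i = G.init → digit c.1 (finFunctionFinEquiv s) i = c.2.2.2.1) ∧
      (¬ i = G.init → digit c.1 (finFunctionFinEquiv s) i = c.2.2.2.2.1)) ↔
      s ∈ (system P G).init := by
  obtain ⟨nq, na, tok, ιt, ιn, δ, lab⟩ := c
  obtain ⟨rfl, rfl, -, rfl, rfl, -, -⟩ := hc
  rw [mem_system_init]
  constructor
  · intro h
    refine ⟨fun i hi => Fin.ext ?_, fun i hi => Fin.ext ?_⟩
    · rw [← digit_finFunctionFinEquiv]
      exact (h i i.2).1 (congrArg Fin.val hi)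
    · rw [← digit_finFunctionFinEquiv]
      exact (h i i.2).2 fun e => hi (Fin.ext e)
  · rintro ⟨h1, h2⟩ i hi
    have := digit_finFunctionFinEquiv s ⟨i, hi⟩
    simp only at this ⊢
    rw [this]
    exact ⟨fun e => congrArg Fin.val (h1 _ (Fin.ext e)),
      fun e => congrArg Fin.val (h2 _ fun e' => e (congrArg Fin.val e'))⟩

end

/-- The algorithm decides the parameterized model checking problem for a family of topologies that
is given by a primitive recursive edge relation and has a cutoff. -/
theorem pmcpDecidable_of_contractsAbove {𝒢 : Set Topology} {V : ℕ → Prop}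
    {E : ℕ → ℕ → ℕ → ℕ → Prop} (hV : PrimrecPred V)
    (hE : PrimrecPred fun x : ℕ × ℕ × ℕ × ℕ => E x.1 x.2.1 x.2.2.1 x.2.2.2)
    (h𝒢 : ∀ G : Topology, G ∈ 𝒢 ↔
      V G.size ∧ ∃ h < G.size, ∀ i j : Fin G.size, G.edge i j ↔ E G.size h i j)
    (hirr : ∀ n, V n → ∀ h, ∀ i < n, ¬ E n h i i)
    (hcut : ∀ k, ContractsAbove 𝒢 k (2 * k + 2)) : PMCPDecidable 𝒢 := by
  obtain ⟨hdec, hprim⟩ := primrecPred_decide hV hE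
  refine ⟨fun x => decide (Decide V E x), hprim.to_comp, fun k Φ q a P c hc => ?_⟩
  -- The bound `2 * k + 2` serves all families at once and is at least `2` even for `k = 0`. It
  -- matches the range `n < 2 * k + 3` in `Decide`.
  rw [decide_eq_true_iff, ← (hcut k).sat_iff (by omega) P Φ]
  have hq : c.1 = q := by
    obtain ⟨nq, na, tok, ιt, ιn, δ, lab⟩ := c
    exact hc.1
  constructor
  · intro h G hG hsize g hguard s hs
    obtain ⟨hV', y, hy, hedge⟩ := (h𝒢 G).1 hG
    have := h G.size (by simp only [UnivFormula.code]; omega) hV' y hy G.init G.init.2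
      (finFunctionFinEquiv g) (Fin.is_lt _) ((guardHolds_iff hedge g Φ).2 hguard)
      (finFunctionFinEquiv s) (by simp only [hq]; exact Fin.is_lt _) ((digits_init_iff hc s).2 hs)
    exact ((represents_numSystem hc hedge g).check_iff Φ.matrix s).1 this
  · intro h n hn hVn y hy v hv γ hγ hguard s hs hinit
    let G : Topology := ⟨n, fun i j => E n y i j, ⟨v, hv⟩, fun i => hirr n hVn y i i.2⟩
    have hedge : ∀ i j : Fin G.size, G.edge i j ↔ E n y i j := fun i j => Iff.rfl
    have hG : G ∈ 𝒢 := (h𝒢 G).2 ⟨hVn, y, hy, hedge⟩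
    obtain ⟨g, hg⟩ : ∃ g : Fin k → Fin G.size, (finFunctionFinEquiv g : ℕ) = γ :=
      ⟨finFunctionFinEquiv.symm ⟨γ, hγ⟩, by simp only [Equiv.apply_symm_apply]⟩
    obtain ⟨s', hs'⟩ : ∃ s' : Fin G.size → Fin q, (finFunctionFinEquiv s' : ℕ) = s :=
      ⟨finFunctionFinEquiv.symm ⟨s, by rw [← hq]; exact hs⟩,
        by simp only [Equiv.apply_symm_apply]⟩
    subst hg hs'
    have hn' : G.size ≤ 2 * k + 2 := Nat.le_of_lt_succ hn
    exact ((represents_numSystem hc hedge g).check_iff Φ.matrix s').2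
      (h G hG hn' g ((guardHolds_iff hedge g Φ).1 hguard) s'
        ((digits_init_iff (G := G) hc s').1 hinit))

/-! ## The four families -/

theorem pmcpDecidable_uniRings : PMCPDecidable uniRings := by
  refine pmcpDecidable_of_contractsAbove (V := fun n => ¬ n < 2)
    (E := fun n _ i j => j = (i + 1) % n) (Prim.not (Prim.lt Prim.self (Prim.const 2))) ?_ ?_ ?_
    fun k => contractsAbove_uniRings (by omega) (by omega)
  · repeat' with_reducible first
      | apply Prim.self | apply Prim.const | apply Prim.eq | apply Prim.mod | apply Prim.add
      | apply Prim.fst | apply Prim.snd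
  · intro G
    -- The edge relation ignores its second argument, so any vertex may be supplied. A ring with one
    -- vertex would have a self-loop, which gives the size bound.
    refine ⟨fun hG => ⟨fun h => ?_, G.init, G.init.2, hG⟩, fun ⟨_, _, _, h⟩ => h⟩
    have := G.init.2
    refine G.irrefl G.init ((hG _ _).2 ?_)
    rw [succ_mod_of_lt this]
    split_ifs <;> omega
  · exact fun n hn h i hi => succ_mod_ne (by omega) hi

theorem pmcpDecidable_biRings : PMCPDecidable biRings := by
  refine pmcpDecidable_of_contractsAbove (V := fun n => ¬ n < 2)
    (E := fun n _ i j => j = (i + 1) % n ∨ i = (j + 1) % n)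
    (Prim.not (Prim.lt Prim.self (Prim.const 2))) ?_ ?_ ?_
    fun k => contractsAbove_biRings (by omega) (by omega)
  · repeat' with_reducible first
      | apply Prim.self | apply Prim.const | apply Prim.or | apply Prim.eq | apply Prim.mod
      | apply Prim.add | apply Prim.fst | apply Prim.snd
  · intro G
    refine ⟨fun hG => ⟨fun h => ?_, G.init, G.init.2, hG⟩, fun ⟨_, _, _, h⟩ => h⟩
    have := G.init.2
    refine G.irrefl G.init ((hG _ _).2 (.inl ?_))
    rw [succ_mod_of_lt this]
    split_ifs <;> omega
  · exact fun n hn h i hi e => succ_mod_ne (by omega) hi (or_self_iff.1 e)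

theorem pmcpDecidable_cliques {m : ℕ} (hm : m ≤ 2) : PMCPDecidable (cliques m) := by
  refine pmcpDecidable_of_contractsAbove (V := fun n => ¬ n < m) (E := fun _ _ i j => ¬ i = j)
    (Prim.not (Prim.lt Prim.self (Prim.const m))) ?_ ?_ ?_
    fun k => contractsAbove_cliques hm (by omega) (by omega)
  · repeat' with_reducible first
      | apply Prim.self | apply Prim.not | apply Prim.eq | apply Prim.fst | apply Prim.snd
  · intro G
    simp only [cliques, Set.mem_ofPred_eq, not_lt, ne_eq, Fin.ext_iff]
    exact ⟨fun ⟨h, h'⟩ => ⟨h, G.init, G.init.2, h'⟩, fun ⟨h, _, _, h'⟩ => ⟨h, h'⟩⟩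
  · exact fun n _ h i _ e => e rfl

theorem pmcpDecidable_stars {m : ℕ} (hm : m ≤ 2) : PMCPDecidable (stars m) := by
  refine pmcpDecidable_of_contractsAbove (V := fun n => ¬ n < m)
    (E := fun _ h i j => ¬ i = j ∧ (i = h ∨ j = h))
    (Prim.not (Prim.lt Prim.self (Prim.const m))) ?_ ?_ ?_
    fun k => contractsAbove_stars hm (by omega) (by omega)
  · repeat' with_reducible first
      | apply Prim.self | apply Prim.and | apply Prim.or | apply Prim.not | apply Prim.eq
      | apply Prim.fst | apply Prim.snd
  · intro G
    simp only [stars, Set.mem_ofPred_eq, not_lt, ne_eq, Fin.ext_iff]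
    exact ⟨fun ⟨h, y, h'⟩ => ⟨h, y, y.2, h'⟩, fun ⟨h, y, hy, h'⟩ => ⟨h, ⟨y, hy⟩, h'⟩⟩
  · exact fun n _ h i _ e => e.1 rfl

end TokenPassing

theorem mainTheorem6 :
    (∀ k : ℕ, 1 ≤ k →
      TokenPassing.IsCutoff.{u, v} TokenPassing.uniRings k (2 * k) ∧
      TokenPassing.IsCutoff.{u, v} TokenPassing.biRings k (2 * k) ∧
      (∀ m : ℕ, m = 1 ∨ m = 2 →
        TokenPassing.IsCutoff.{u, v} (TokenPassing.cliques m) k (k + 1) ∧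
        TokenPassing.IsCutoff.{u, v} (TokenPassing.stars m) k (k + 1))) ∧
    (TokenPassing.PMCPDecidable TokenPassing.uniRings ∧
      TokenPassing.PMCPDecidable TokenPassing.biRings ∧
      (∀ m : ℕ, m = 1 ∨ m = 2 →
        TokenPassing.PMCPDecidable (TokenPassing.cliques m) ∧
        TokenPassing.PMCPDecidable (TokenPassing.stars m))) := by
  open TokenPassing in
  refine ⟨fun k hk => ⟨?_, ?_, fun m hm => ⟨?_, ?_⟩⟩, pmcpDecidable_uniRings,
    pmcpDecidable_biRings, fun m hm => ⟨pmcpDecidable_cliques (by omega),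
      pmcpDecidable_stars (by omega)⟩⟩
  -- `1 ≤ k` makes `2 * k` and, below, `k + 1` at least `2`, so no topology is contracted to a
  -- single vertex.
  · exact (contractsAbove_uniRings (by omega) le_rfl).isCutoff (by omega)
  · exact (contractsAbove_biRings (by omega) le_rfl).isCutoff (by omega)
  · exact (contractsAbove_cliques (by omega) (by omega) le_rfl).isCutoff (by omega)
  · exact (contractsAbove_stars (by omega) (by omega) le_rfl).isCutoff (by omega)
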